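/- Let $N\ge 3$ and let $$\mathcal E:\ \frac{x^2}{a^2}+\frac{y^2}{b^2}=1\quad(0<b<a),\qquad \mathcal E':\ \frac{x^2}{a'^2}+\frac{y^2}{b'^2}=1\quad(0<a'<a,\ b'>0)$$ be confocal ellipses, i.e. $a'^2-b'^2=a^2-b^2=:c^2$ with $c>0$. An *$N$-periodic of the elliptic billiard $(\mathcal E,\mathcal E')$* is a closed polygon $P=(P_j)_{j\in\mathbb Z/N}$ that is a billiard trajectory in $\mathcal E$ (its vertices lie on $\mathcal E$, consecutive vertices are distinct, and at each vertex the direction of motion is reflected in the tangent line of $\mathcal E$) and all of whose sides lie on tangent lines of $\mathcal E'$. Let $f_1$ be either of the common foci $(\pm c,0)$, let $\rho>0$, and let $\mathcal C$ be the circle with centre $f_1$ and radius $\rho$. For a point $p\neq f_1$ let $p^\dagger$ be its inverse in $\mathcal C$; its polar is the line through $p^\dagger$ perpendicular to $f_1p$, and $p$ is called the pole of that line. 1. The perimeter of the inverted polygon $P^\dagger=(P_j^\dagger)_j$ is the same for all $N$-periodics $P$ of $(\mathcal E,\mathcal E')$; it depends only on $\mathcal E,\mathcal E',N,f_1,\rho$.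 2. The polar images of $\mathcal E$ and $\mathcal E'$ (the sets of the poles of their tangent lines) are circles $\mathcal C_{int}$ and $\mathcal C_{ext}$, with $\mathcal C_{int}$ strictly inside $\mathcal C_{ext}$. The point $f_1$ is the limiting point $\ell_1$ of this pair that lies inside both circles: it lies on the line of centres, and the inversions with centre $f_1$ send the two circles to concentric circles. 3. Call a closed polygon $Q=(Q_j)_{j\in\mathbb Z/N}$ *bicentric* if it is inscribed in $\mathcal C_{ext}$, all its sidelines are tangent to $\mathcal C_{int}$, and $Q_{j-1}\neq Q_{j+1}$ for all $j$. For every $N$-periodic $P$, the polygon $Q$ whose vertices $Q_j$ are the poles of the sidelines $P_jP_{j+1}$ is bicentric, and every bicentric $N$-gon $Q$ arises in this way from an $N$-periodic $P$. In both cases the pedal polygon of $Q$ with respect to $\ell_1=f_1$, whose vertices are the feet of the perpendiculars from $f_1$ to the sidelines $Q_jQ_{j+1}$, coincides with the inverted polygon $P^\dagger$: its $j$-th vertex is $P_{j+1}^\dagger$. -/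

import Mathlib

open EuclideanGeometry

noncomputable section

namespace ConfocalBilliard

/-- The Euclidean plane. -/
abbrev Plane : Type := EuclideanSpace ℝ (Fin 2)

/-- The ellipse `x²/a² + y²/b² = 1`. -/
def ellipse (a b : ℝ) : Set Plane := {p | p 0 ^ 2 / a ^ 2 + p 1 ^ 2 / b ^ 2 = 1}

/-- The two foci `(-c, 0)` and `(c, 0)`, `c = √(a² - b²)`, of `ellipse a b` (for `0 < b ≤ a`). -/
def foci (a b : ℝ) : Set Plane := {!₂[-√(a ^ 2 - b ^ 2), 0], !₂[√(a ^ 2 - b ^ 2), 0]}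

/-- A normal vector of `ellipse a b` at its point `p` (half the gradient of the equation). -/
def ellipseNormal (a b : ℝ) (p : Plane) : Plane := !₂[p 0 / a ^ 2, p 1 / b ^ 2]

/-- `L` is a line that meets `S` in exactly one point. For an ellipse or a circle `S` these are
exactly the tangent lines. -/
def IsTangentLine (S : Set Plane) (L : AffineSubspace ℝ Plane) : Prop :=
  Module.finrank ℝ L.direction = 1 ∧ ∃! x, x ∈ S ∧ x ∈ L

/-- The unit vector pointing from `p` to `q` (for `p ≠ q`). -/
def unitVec (p q : Plane) : Plane := ‖q - p‖⁻¹ • (q - p)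

/-- A closed polygon with `N` cyclically indexed vertices. -/
abbrev Polygon (N : ℕ) : Type := ZMod N → Plane

/-- The line carrying the `j`-th side. -/
def sideline {N : ℕ} (P : Polygon N) (j : ZMod N) : AffineSubspace ℝ Plane :=
  line[ℝ, P j, P (j + 1)]

/-- The perimeter of a closed polygon. -/
def perimeter {N : ℕ} [NeZero N] (P : Polygon N) : ℝ := ∑ j, dist (P j) (P (j + 1))

/-- `P` is a closed billiard trajectory in `ellipse a b`: the vertices lie on the ellipse, and at
every vertex the direction of motion is reflected in the tangent line of the ellipse. -/
structure IsBilliardOrbit (a b : ℝ) {N : ℕ} (P : Polygon N) : Prop where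
  mem : ∀ j, P j ∈ ellipse a b
  ne : ∀ j, P j ≠ P (j + 1)
  reflects : ∀ j, (ℝ ∙ ellipseNormal a b (P j))ᗮ.reflection (unitVec (P (j - 1)) (P j)) =
    unitVec (P j) (P (j + 1))

/-- The `N`-periodics of the confocal pair `ellipse a b`, `ellipse a' b'`: closed billiard
trajectories in the first ellipse, all of whose sidelines are tangent to the second (the caustic). -/
def periodics (a b a' b' : ℝ) (N : ℕ) : Set (Polygon N) :=
  {P | IsBilliardOrbit a b P ∧ ∀ j, IsTangentLine (ellipse a' b') (sideline P j)}

/-- The image of a polygon under the inversion in the circle with centre `f` and radius `ρ`. -/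
def invert (f : Plane) (ρ : ℝ) {N : ℕ} (P : Polygon N) : Polygon N :=
  fun j => inversion f ρ (P j)

/-- The polar line of a point `q ≠ f` with respect to the circle with centre `f` and radius `ρ`:
the line through the inverse of `q` that is perpendicular to `q - f`. -/
def polarLine (f : Plane) (ρ : ℝ) (q : Plane) : AffineSubspace ℝ Plane :=
  AffineSubspace.mk' (inversion f ρ q) (ℝ ∙ (q - f))ᗮ

/-- `q` is the pole of the line `L` with respect to the circle with centre `f` and radius `ρ`. -/
def IsPole (f : Plane) (ρ : ℝ) (q : Plane) (L : AffineSubspace ℝ Plane) : Prop :=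
  q ≠ f ∧ L = polarLine f ρ q

/-- The polar curve of an ellipse (or circle) `S`: the set of the poles of its tangent lines. -/
def polarCurve (f : Plane) (ρ : ℝ) (S : Set Plane) : Set Plane :=
  {q | ∃ L, IsTangentLine S L ∧ IsPole f ρ q L}

/-- `Q` is the polar polygon of `P`: its vertices are the poles of the consecutive sidelines. -/
def IsPolarPolygon (f : Plane) (ρ : ℝ) {N : ℕ} (P Q : Polygon N) : Prop :=
  ∀ j, IsPole f ρ (Q j) (sideline P j)

instance {N : ℕ} (P : Polygon N) (j : ZMod N) : Nonempty (sideline P j) :=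
  ⟨⟨P j, left_mem_affineSpan_pair ℝ (P j) (P (j + 1))⟩⟩

/-- The pedal polygon of `Q` with respect to `f`: the feet of the perpendiculars from `f` to the
sidelines. -/
def pedal (f : Plane) {N : ℕ} (Q : Polygon N) : Polygon N :=
  fun j => (orthogonalProjection (sideline Q j) f : Plane)

/-- The bicentric `N`-gons of the circles `Cext` and `Cint`: inscribed in `Cext`, all sidelines
tangent to `Cint`. As usual for Poncelet polygons, the two sides at a vertex lie on the two
different tangents from it, i.e. the polygon does not double back. -/
def bicentrics (Cext Cint : Sphere Plane) (N : ℕ) : Set (Polygon N) :=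
  {Q | (∀ j, Q j ∈ Cext) ∧ (∀ j, Q (j - 1) ≠ Q (j + 1)) ∧
    ∀ j, IsTangentLine (Cint : Set Plane) (sideline Q j)}

/-- `l` is a limiting point of the two circles: it lies on the line of the centres, and every
inversion with centre `l` sends the two circles to concentric circles. -/
def IsLimitingPoint (C₁ C₂ : Sphere Plane) (l : Plane) : Prop :=
  l ∈ line[ℝ, C₁.center, C₂.center] ∧ ∀ k : ℝ, 0 < k → ∃ (m : Plane) (s₁ s₂ : ℝ),
    0 < s₁ ∧ 0 < s₂ ∧ inversion l k '' (C₁ : Set Plane) = Metric.sphere m s₁ ∧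
      inversion l k '' (C₂ : Set Plane) = Metric.sphere m s₂

end ConfocalBilliard

end

open ConfocalBilliard

/-! Polarity in a circle centred at a focus turns an ellipse into a circle. Since $\mathcal E$ and
$\mathcal E'$ share the focus $f$, both become circles at once: tangents of $\mathcal E'$ correspond
to points of $\mathcal C_{ext}$, and points of $\mathcal E$ to tangents of $\mathcal C_{int}$. Hence
the poles of the sides of a periodic lie on $\mathcal C_{ext}$, and the line joining two consecutive
poles is the polar of the common vertex, tangent to $\mathcal C_{int}$. The foot of the
perpendicular from $f$ to a polar line is the inverse of its pole, so the pedal polygon is the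
inverted one. The reflection law is translated by `reflects_iff_ne`: two tangents to the caustic
through a point of $\mathcal E$ make equal angles with the normal, so the law only says that the
motion does not run back along the side it came from. This matches the condition $Q_{j-1}\ne
Q_{j+1}$.

For the perimeter, put the origin at the centre of $\mathcal C_{int}$ and let $\alpha_j$ be the
contact angle of the side of $Q$ dual to $P_j$. On $\mathcal C_{ext}$ the tangent length to
$\mathcal C_{int}$ is a constant multiple of the distance to the limiting point $f$. With this,
`dist_feet` makes each side of $P^\dagger$ an affine function of $\cos\alpha_j+\cos\alpha_{j+1}$
with fixed coefficients, so it remains to see that $\sum_j\cos\alpha_j$ is constant (Weill).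

With $T(\varphi)$ the tangent length from a point of the outer circle, the Poncelet map is a
translation in the parameter $\int d\varphi/T$ (`exists_ponceletParam_endAngle`). In this parameter
$\alpha$ moves with speed equal to the half chord $h$, so $\cos\alpha$ has derivative
$-h\sin\alpha$, half the difference of the abscissas of the endpoints of the chord. Around a closed
polygon these differences telescope to zero. -/

noncomputable section

namespace ConfocalBilliard

/-! ### Poncelet's translation parameter and Weill's theorem for a pair of circles -/

section Poncelet

open Real

/-- Half the length of the chord that the circle of radius `R` about `(δ, 0)` cuts out of the
tangent line of the circle of radius `r` about the origin with contact angle `α`. -/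
def halfChord (r δ R α : ℝ) : ℝ := √(R ^ 2 - (r - δ * cos α) ^ 2)

/-- Half the central angle of that chord. -/
def halfAngle (r δ R α : ℝ) : ℝ := arccos ((r - δ * cos α) / R)

/-- The length of the tangents from the point of the outer circle at central angle `φ` to the
inner circle. -/
def tangentLength (r δ R φ : ℝ) : ℝ := √(R ^ 2 + 2 * R * δ * cos φ + δ ^ 2 - r ^ 2)

/-- The central angle of the final endpoint of the chord with contact angle `α`. -/
def endAngle (r δ R α : ℝ) : ℝ := α + halfAngle r δ R α

/-- The central angle of the initial endpoint of the chord with contact angle `α`. -/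
def startAngle (r δ R α : ℝ) : ℝ := α - halfAngle r δ R α

/-- The parameter on the outer circle in which the Poncelet map is a translation. -/
def ponceletParam (r δ R φ : ℝ) : ℝ := ∫ x in (0 : ℝ)..φ, (tangentLength r δ R x)⁻¹

variable {r δ R : ℝ}

theorem abs_offset_lt (hr : 0 < r) (hR : r + |δ| < R) (α : ℝ) :
    |r - δ * cos α| < R := by
  have h1 : |δ * cos α| ≤ |δ| := by
    rw [abs_mul]; exact mul_le_of_le_one_right (abs_nonneg _) (abs_cos_le_one _)
  have h2 : |r - δ * cos α| ≤ |r| + |δ * cos α| := abs_sub _ _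
  rw [abs_of_pos hr] at h2
  linarith

theorem radius_pos (hr : 0 < r) (hR : r + |δ| < R) : 0 < R := by
  linarith [abs_nonneg δ]

theorem halfChord_sq_pos (hr : 0 < r) (hR : r + |δ| < R) (α : ℝ) :
    0 < R ^ 2 - (r - δ * cos α) ^ 2 := by
  have := sq_lt_sq' (by linarith [neg_abs_le (r - δ * cos α), abs_offset_lt hr hR α])
    (lt_of_le_of_lt (le_abs_self _) (abs_offset_lt hr hR α))
  linarith

theorem halfChord_pos (hr : 0 < r) (hR : r + |δ| < R) (α : ℝ) : 0 < halfChord r δ R α :=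
  sqrt_pos.2 (halfChord_sq_pos hr hR α)

theorem sq_halfChord (hr : 0 < r) (hR : r + |δ| < R) (α : ℝ) :
    halfChord r δ R α ^ 2 = R ^ 2 - (r - δ * cos α) ^ 2 :=
  sq_sqrt (halfChord_sq_pos hr hR α).le

theorem abs_offset_div_lt (hr : 0 < r) (hR : r + |δ| < R) (α : ℝ) :
    |(r - δ * cos α) / R| < 1 := by
  rw [abs_div, abs_of_pos (radius_pos hr hR), div_lt_one (radius_pos hr hR)]
  exact abs_offset_lt hr hR α

theorem radius_mul_cos_halfAngle (hr : 0 < r) (hR : r + |δ| < R) (α : ℝ) :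
    R * cos (halfAngle r δ R α) = r - δ * cos α := by
  have := abs_lt.1 (abs_offset_div_lt hr hR α)
  rw [halfAngle, cos_arccos this.1.le this.2.le, mul_div_cancel₀ _ (radius_pos hr hR).ne']

theorem radius_mul_sqrt (hr : 0 < r) (hR : r + |δ| < R) (α : ℝ) :
    R * √(1 - ((r - δ * cos α) / R) ^ 2) = halfChord r δ R α := by
  have hR0 := radius_pos hr hR
  rw [halfChord]
  nth_rewrite 1 [← sqrt_sq hR0.le]
  rw [← sqrt_mul (sq_nonneg R)]
  congr 1
  field_simp

theorem radius_mul_sin_halfAngle (hr : 0 < r) (hR : r + |δ| < R) (α : ℝ) :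
    R * sin (halfAngle r δ R α) = halfChord r δ R α := by
  rw [halfAngle, sin_arccos, radius_mul_sqrt hr hR]

/-- Seen from the centre $(\delta,0)$, an endpoint of the chord is the foot
$(r-\delta\cos\alpha)(\cos\alpha,\sin\alpha)$ plus or minus $h(-\sin\alpha,\cos\alpha)$. -/
theorem radius_mul_cos_endAngle (hr : 0 < r) (hR : r + |δ| < R) (α : ℝ) :
    R * cos (endAngle r δ R α) = cos α * (r - δ * cos α) - sin α * halfChord r δ R α := by
  rw [endAngle, cos_add, ← radius_mul_cos_halfAngle hr hR, ← radius_mul_sin_halfAngle hr hR]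
  ring

theorem radius_mul_sin_endAngle (hr : 0 < r) (hR : r + |δ| < R) (α : ℝ) :
    R * sin (endAngle r δ R α) = sin α * (r - δ * cos α) + cos α * halfChord r δ R α := by
  rw [endAngle, sin_add, ← radius_mul_cos_halfAngle hr hR, ← radius_mul_sin_halfAngle hr hR]
  ring

theorem radius_mul_cos_startAngle (hr : 0 < r) (hR : r + |δ| < R) (α : ℝ) :
    R * cos (startAngle r δ R α) = cos α * (r - δ * cos α) + sin α * halfChord r δ R α := by
  rw [startAngle, cos_sub, ← radius_mul_cos_halfAngle hr hR, ← radius_mul_sin_halfAngle hr hR]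
  ring

theorem radius_mul_sin_startAngle (hr : 0 < r) (hR : r + |δ| < R) (α : ℝ) :
    R * sin (startAngle r δ R α) = sin α * (r - δ * cos α) - cos α * halfChord r δ R α := by
  rw [startAngle, sin_sub, ← radius_mul_cos_halfAngle hr hR, ← radius_mul_sin_halfAngle hr hR]
  ring

theorem hasDerivAt_halfAngle (hr : 0 < r) (hR : r + |δ| < R) (α : ℝ) :
    HasDerivAt (halfAngle r δ R) (-(δ * sin α) / halfChord r δ R α) α := by
  have hR0 := radius_pos hr hR
  have h1 := abs_lt.1 (abs_offset_div_lt hr hR α)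
  have h2 : HasDerivAt (fun x => (r - δ * cos x) / R) (δ * sin α / R) α := by
    have := (((hasDerivAt_cos α).const_mul δ).const_sub r).div_const R
    exact this.congr_deriv (by ring)
  have h3 := (hasDerivAt_arccos h1.1.ne' h1.2.ne).comp α h2
  refine HasDerivAt.congr_deriv (f := halfAngle r δ R) h3 ?_
  rw [← radius_mul_sqrt hr hR]
  field_simp

/-- The contact point is at distance $|\delta\sin\alpha|$ from the midpoint of the chord, and it
lies strictly inside the outer circle. -/
theorem abs_mul_sin_lt_halfChord (hr : 0 < r) (hR : r + |δ| < R) (α : ℝ) :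
    |δ * sin α| < halfChord r δ R α := by
  apply lt_of_pow_lt_pow_left₀ 2 (halfChord_pos hr hR α).le
  rw [sq_abs, sq_halfChord hr hR]
  have h1 : |δ * cos α| ≤ |δ| := by
    rw [abs_mul]; exact mul_le_of_le_one_right (abs_nonneg _) (abs_cos_le_one _)
  have h2 := (abs_le.1 h1).1
  have h3 : (r + |δ|) ^ 2 < R ^ 2 := by
    have := abs_nonneg δ
    gcongr
  nlinarith [sin_sq_add_cos_sq α, sq_abs δ]

theorem tangentLength_sq_pos (hr : 0 < r) (hR : r + |δ| < R) (φ : ℝ) :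
    0 < R ^ 2 + 2 * R * δ * cos φ + δ ^ 2 - r ^ 2 := by
  have h1 : |δ * cos φ| ≤ |δ| := by
    rw [abs_mul]; exact mul_le_of_le_one_right (abs_nonneg _) (abs_cos_le_one _)
  have h2 := (abs_le.1 h1).1
  have h3 : r ^ 2 < (R - |δ|) ^ 2 := by
    have : r < R - |δ| := by linarith
    gcongr
  nlinarith [sq_abs δ, radius_pos hr hR]

theorem tangentLength_pos (hr : 0 < r) (hR : r + |δ| < R) (φ : ℝ) : 0 < tangentLength r δ R φ :=
  sqrt_pos.2 (tangentLength_sq_pos hr hR φ)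

/-- Both sides are the distance from the contact point to the final endpoint; at the initial
endpoint the sign of the offset $\delta\sin\alpha$ changes. -/
theorem tangentLength_endAngle (hr : 0 < r) (hR : r + |δ| < R) (α : ℝ) :
    tangentLength r δ R (endAngle r δ R α) = halfChord r δ R α - δ * sin α := by
  have h1 := radius_mul_cos_endAngle hr hR α
  have h2 := sq_halfChord hr hR α
  have h3 := (abs_lt.1 (abs_mul_sin_lt_halfChord hr hR α)).2
  rw [tangentLength, sqrt_eq_iff_mul_self_eq (tangentLength_sq_pos hr hR _).le (by linarith)]
  linear_combination 2 * δ * h1 - h2 - δ ^ 2 * sin_sq_add_cos_sq α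

theorem tangentLength_startAngle (hr : 0 < r) (hR : r + |δ| < R) (α : ℝ) :
    tangentLength r δ R (startAngle r δ R α) = halfChord r δ R α + δ * sin α := by
  have h1 := radius_mul_cos_startAngle hr hR α
  have h2 := sq_halfChord hr hR α
  have h3 := (abs_lt.1 (abs_mul_sin_lt_halfChord hr hR α)).1
  rw [tangentLength, sqrt_eq_iff_mul_self_eq (tangentLength_sq_pos hr hR _).le (by linarith)]
  linear_combination 2 * δ * h1 - h2 - δ ^ 2 * sin_sq_add_cos_sq α

theorem continuous_inv_tangentLength (hr : 0 < r) (hR : r + |δ| < R) :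
    Continuous fun x => (tangentLength r δ R x)⁻¹ := by
  apply Continuous.inv₀
  · unfold tangentLength
    fun_prop
  · exact fun x => (tangentLength_pos hr hR x).ne'

theorem hasDerivAt_ponceletParam (hr : 0 < r) (hR : r + |δ| < R) (φ : ℝ) :
    HasDerivAt (ponceletParam r δ R) (tangentLength r δ R φ)⁻¹ φ :=
  (continuous_inv_tangentLength hr hR).integral_hasStrictDerivAt 0 φ |>.hasDerivAt

theorem strictMono_ponceletParam (hr : 0 < r) (hR : r + |δ| < R) :
    StrictMono (ponceletParam r δ R) :=
  strictMono_of_hasDerivAt_pos (fun φ => hasDerivAt_ponceletParam hr hR φ)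
    fun φ => inv_pos.2 (tangentLength_pos hr hR φ)

theorem ponceletParam_add_two_pi (hr : 0 < r) (hR : r + |δ| < R) (φ : ℝ) :
    ponceletParam r δ R (φ + 2 * π) = ponceletParam r δ R φ + ponceletParam r δ R (2 * π) := by
  have hp : Function.Periodic (fun x => (tangentLength r δ R x)⁻¹) (2 * π) := by
    intro x
    simp [tangentLength]
  have hi := fun a b => (continuous_inv_tangentLength hr hR).intervalIntegrable
    (μ := MeasureTheory.volume) a b
  have := hp.intervalIntegral_add_eq φ 0
  rw [zero_add] at this
  unfold ponceletParam
  rw [← this, intervalIntegral.integral_add_adjacent_intervals (hi _ _) (hi _ _)]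

theorem ponceletParam_add_int_mul (hr : 0 < r) (hR : r + |δ| < R) (φ : ℝ) (n : ℤ) :
    ponceletParam r δ R (φ + n * (2 * π)) =
      ponceletParam r δ R φ + n * ponceletParam r δ R (2 * π) := by
  have h : ∀ (n : ℕ) φ, ponceletParam r δ R (φ + n * (2 * π)) =
      ponceletParam r δ R φ + n * ponceletParam r δ R (2 * π) := by
    intro n
    induction n with
    | zero => simp
    | succ k ih =>
      intro φ
      have := ponceletParam_add_two_pi hr hR (φ + k * (2 * π))
      rw [ih] at this
      push_cast
      rw [show φ + ((k : ℝ) + 1) * (2 * π) = φ + k * (2 * π) + 2 * π by ring, this]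
      ring
  obtain ⟨m, rfl | rfl⟩ := n.eq_nat_or_neg
  · exact_mod_cast h m φ
  · have := h m (φ + (-(m : ℤ) : ℤ) * (2 * π))
    push_cast at this ⊢
    rw [show φ + -(m : ℝ) * (2 * π) + m * (2 * π) = φ by ring] at this
    linarith

theorem halfAngle_add_int_mul (α : ℝ) (n : ℤ) :
    halfAngle r δ R (α + n * (2 * π)) = halfAngle r δ R α := by
  simp [halfAngle, cos_add_int_mul_two_pi]

theorem startAngle_add_int_mul (α : ℝ) (n : ℤ) :
    startAngle r δ R (α + n * (2 * π)) = startAngle r δ R α + n * (2 * π) := by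
  rw [startAngle, halfAngle_add_int_mul, startAngle]; ring

/-- The parameter of the initial endpoint of the chord with contact angle `α`. -/
def chordParam (r δ R α : ℝ) : ℝ := ponceletParam r δ R (startAngle r δ R α)

/-- When the tangent rolls along the inner circle, each endpoint moves at angular speed $T/h$.
Division by $T$ leaves $1/h$, which is the same for both endpoints; this is why the Poncelet map
becomes a translation. -/
theorem hasDerivAt_chordParam (hr : 0 < r) (hR : r + |δ| < R) (α : ℝ) :
    HasDerivAt (chordParam r δ R) (halfChord r δ R α)⁻¹ α := by
  have h1 : HasDerivAt (startAngle r δ R) (1 - -(δ * sin α) / halfChord r δ R α) α :=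
    (hasDerivAt_id α).sub (hasDerivAt_halfAngle hr hR α)
  have h2 := (hasDerivAt_ponceletParam hr hR (startAngle r δ R α)).comp α h1
  refine HasDerivAt.congr_deriv (f := chordParam r δ R) h2 ?_
  have h3 := tangentLength_startAngle hr hR α
  have h4 := (tangentLength_pos hr hR (startAngle r δ R α)).ne'
  rw [h3] at h4 ⊢
  have h5 := (halfChord_pos hr hR α).ne'
  field_simp
  ring

theorem hasDerivAt_ponceletParam_endAngle (hr : 0 < r) (hR : r + |δ| < R) (α : ℝ) :
    HasDerivAt (fun α => ponceletParam r δ R (endAngle r δ R α)) (halfChord r δ R α)⁻¹ α := by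
  have h1 : HasDerivAt (endAngle r δ R) (1 + -(δ * sin α) / halfChord r δ R α) α :=
    (hasDerivAt_id α).add (hasDerivAt_halfAngle hr hR α)
  have h2 := (hasDerivAt_ponceletParam hr hR (endAngle r δ R α)).comp α h1
  refine h2.congr_deriv ?_
  have h3 := tangentLength_endAngle hr hR α
  have h4 := (tangentLength_pos hr hR (endAngle r δ R α)).ne'
  rw [h3] at h4 ⊢
  have h5 := (halfChord_pos hr hR α).ne'
  field_simp
  ring

/-- The Poncelet map is a translation in the Poncelet parameter. -/
theorem exists_ponceletParam_endAngle (hr : 0 < r) (hR : r + |δ| < R) :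
    ∃ κ, ∀ α, ponceletParam r δ R (endAngle r δ R α) = chordParam r δ R α + κ := by
  refine ⟨ponceletParam r δ R (endAngle r δ R 0) - chordParam r δ R 0, fun α => ?_⟩
  have h : ∀ x, HasDerivAt
      (fun α => ponceletParam r δ R (endAngle r δ R α) - chordParam r δ R α) 0 x := by
    intro x
    exact ((hasDerivAt_ponceletParam_endAngle hr hR x).sub
      (hasDerivAt_chordParam hr hR x)).congr_deriv (sub_self _)
  have := is_const_of_deriv_eq_zero (fun x => (h x).differentiableAt) (fun x => (h x).deriv) α 0
  linarith

theorem strictMono_chordParam (hr : 0 < r) (hR : r + |δ| < R) :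
    StrictMono (chordParam r δ R) :=
  strictMono_of_hasDerivAt_pos (fun φ => hasDerivAt_chordParam hr hR φ)
    fun φ => inv_pos.2 (halfChord_pos hr hR φ)

theorem chordParam_add_int_mul (hr : 0 < r) (hR : r + |δ| < R) (α : ℝ) (n : ℤ) :
    chordParam r δ R (α + n * (2 * π)) = chordParam r δ R α + n * ponceletParam r δ R (2 * π) := by
  rw [chordParam, startAngle_add_int_mul, ponceletParam_add_int_mul hr hR, chordParam]

theorem ponceletParam_two_pi_pos (hr : 0 < r) (hR : r + |δ| < R) :
    0 < ponceletParam r δ R (2 * π) := by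
  have := strictMono_ponceletParam hr hR two_pi_pos
  simpa [ponceletParam] using this

theorem surjective_chordParam (hr : 0 < r) (hR : r + |δ| < R) :
    Function.Surjective (chordParam r δ R) := by
  have hc : Continuous (chordParam r δ R) :=
    continuous_iff_continuousAt.2 fun x => (hasDerivAt_chordParam hr hR x).continuousAt
  have hΩ := ponceletParam_two_pi_pos hr hR
  intro y
  obtain ⟨n, hn⟩ := exists_nat_gt (|y - chordParam r δ R 0| / ponceletParam r δ R (2 * π))
  rw [div_lt_iff₀ hΩ] at hn
  have hn' := abs_lt.1 hn
  have h1 := chordParam_add_int_mul hr hR 0 n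
  have h2 := chordParam_add_int_mul hr hR 0 (-n)
  push_cast at h1 h2
  exact mem_range_of_exists_le_of_exists_ge hc ⟨_, by rw [h2]; linarith⟩ ⟨_, by rw [h1]; linarith⟩

/-- The contact angle as a function of the Poncelet parameter. -/
theorem exists_inverse_chordParam (hr : 0 < r) (hR : r + |δ| < R) :
    ∃ A : ℝ → ℝ, (∀ x, chordParam r δ R (A x) = x) ∧ (∀ α, A (chordParam r δ R α) = α) ∧
      ∀ x, HasDerivAt A (halfChord r δ R (A x)) x := by
  let e := (strictMono_chordParam hr hR).orderIsoOfSurjective _ (surjective_chordParam hr hR)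
  have he : ∀ x, chordParam r δ R (e.symm x) = x := fun x => e.apply_symm_apply x
  refine ⟨e.symm, he, fun α => e.symm_apply_apply α, fun x => ?_⟩
  have := (hasDerivAt_chordParam hr hR (e.symm x)).of_local_left_inverse
    e.symm.continuous.continuousAt (inv_ne_zero (halfChord_pos hr hR _).ne')
    (Filter.Eventually.of_forall he)
  simpa using this

theorem exists_startAngle_eq {α β : ℝ}
    (hc : cos (endAngle r δ R α) = cos (startAngle r δ R β))
    (hs : sin (endAngle r δ R α) = sin (startAngle r δ R β)) :
    ∃ n : ℤ, startAngle r δ R β = endAngle r δ R α + n * (2 * π) := by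
  have : (startAngle r δ R β : Real.Angle) = (endAngle r δ R α : Real.Angle) :=
    Real.Angle.cos_sin_inj hc.symm hs.symm
  obtain ⟨n, hn⟩ := Real.Angle.angle_eq_iff_two_pi_dvd_sub.1 this
  exact ⟨n, by linarith⟩

/-- Equality of final endpoints forces equality of the chords. -/
theorem cos_sin_eq_of_endAngle (hr : 0 < r) (hR : r + |δ| < R) {α β : ℝ}
    (hc : cos (endAngle r δ R α) = cos (endAngle r δ R β))
    (hs : sin (endAngle r δ R α) = sin (endAngle r δ R β)) :
    cos α = cos β ∧ sin α = sin β := by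
  obtain ⟨κ, hκ⟩ := exists_ponceletParam_endAngle hr hR
  have : (endAngle r δ R α : Real.Angle) = (endAngle r δ R β : Real.Angle) :=
    Real.Angle.cos_sin_inj hc hs
  obtain ⟨n, hn⟩ := Real.Angle.angle_eq_iff_two_pi_dvd_sub.1 this
  have h1 := ponceletParam_add_int_mul hr hR (endAngle r δ R β) n
  rw [show endAngle r δ R β + n * (2 * π) = endAngle r δ R α by linarith, hκ, hκ] at h1
  have h2 := chordParam_add_int_mul hr hR β n
  have h3 : α = β + n * (2 * π) := (strictMono_chordParam hr hR).injective (by linarith)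
  rw [h3]
  exact ⟨cos_add_int_mul_two_pi _ _, sin_add_int_mul_two_pi _ _⟩

theorem sum_zmod_eq_sum_range {N : ℕ} [NeZero N] (g : ZMod N → ℝ) :
    ∑ j, g j = ∑ i ∈ Finset.range N, g (i : ZMod N) := by
  symm
  apply Finset.sum_bij (fun (i : ℕ) _ => (i : ZMod N))
  · simp
  · intro i hi j hj h
    rw [ZMod.natCast_eq_natCast_iff'] at h
    rwa [Nat.mod_eq_of_lt (Finset.mem_range.1 hi), Nat.mod_eq_of_lt (Finset.mem_range.1 hj)] at h
  · intro b _
    exact ⟨b.val, Finset.mem_range.2 b.val_lt, by simp⟩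
  · simp

/-- **Weill's theorem**: along the Poncelet polygons with `N` sides the abscissa of the centroid of
the contact points is constant. -/
theorem exists_sum_cos_contactAngle_eq (hr : 0 < r) (hR : r + |δ| < R) (N : ℕ) [NeZero N] :
    ∃ S₀ : ℝ, ∀ α : ZMod N → ℝ,
      (∀ j, cos (endAngle r δ R (α j)) = cos (startAngle r δ R (α (j + 1))) ∧
        sin (endAngle r δ R (α j)) = sin (startAngle r δ R (α (j + 1)))) →
      ∑ j, cos (α j) = S₀ := by
  obtain ⟨κ, hκ⟩ := exists_ponceletParam_endAngle hr hR
  obtain ⟨A, hA1, hA2, hA3⟩ := exists_inverse_chordParam hr hR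
  set Ω := ponceletParam r δ R (2 * π) with hΩ
  have hAper : ∀ x (n : ℤ), A (x + n * Ω) = A x + n * (2 * π) := by
    intro x n
    rw [← hA2 (A x + n * (2 * π)), chordParam_add_int_mul hr hR, hA1]
  -- The sum over $N$ Poncelet steps from parameter `x`, closed or not. Only the existence of a
  -- closed polygon makes it constant in `x`; otherwise `S 0` is a vacuous choice.
  let S : ℝ → ℝ := fun x => ∑ i ∈ Finset.range N, cos (A (x + i * κ))
  refine ⟨S 0, fun α h => ?_⟩
  have hstep : ∀ j, ∃ n : ℤ, chordParam r δ R (α (j + 1)) = chordParam r δ R (α j) + κ + n * Ω := by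
    intro j
    obtain ⟨n, hn⟩ := exists_startAngle_eq (h j).1 (h j).2
    refine ⟨n, ?_⟩
    rw [chordParam, hn, ponceletParam_add_int_mul hr hR, hκ]
  choose n hn using hstep
  -- Adding the steps around the polygon: $N$ translations amount to whole turns. No starting point
  -- enters, so every Poncelet orbit closes.
  have hclose : N * κ + (∑ j, n j : ℤ) * Ω = 0 := by
    have h1 : ∑ j, chordParam r δ R (α (j + 1)) = ∑ j, chordParam r δ R (α j) :=
      Equiv.sum_comp (Equiv.addRight (1 : ZMod N)) fun j => chordParam r δ R (α j)
    simp only [hn, Finset.sum_add_distrib] at h1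
    simp only [Finset.sum_const, Finset.card_univ, ZMod.card, nsmul_eq_mul, ← Finset.sum_mul] at h1
    push_cast
    linarith
  have hiter : ∀ i : ℕ, ∃ m : ℤ,
      chordParam r δ R (α (i : ZMod N)) = chordParam r δ R (α 0) + i * κ + m * Ω := by
    intro i
    induction i with
    | zero => exact ⟨0, by simp⟩
    | succ i ih =>
      obtain ⟨m, hm⟩ := ih
      refine ⟨m + n i, ?_⟩
      push_cast
      rw [hn, hm]
      ring
  have hsum : ∑ j, cos (α j) = S (chordParam r δ R (α 0)) := by
    rw [sum_zmod_eq_sum_range]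
    refine Finset.sum_congr rfl fun i _ => ?_
    obtain ⟨m, hm⟩ := hiter i
    rw [← hA2 (α i), hm, hAper, cos_add_int_mul_two_pi]
  have hnext : ∀ x, startAngle r δ R (A (x + κ)) = endAngle r δ R (A x) := by
    intro x
    apply (strictMono_ponceletParam hr hR).injective
    rw [hκ, hA1]
    exact hA1 (x + κ)
  have hderiv : ∀ x, HasDerivAt S 0 x := by
    intro x
    -- `D` is half the abscissa of the initial endpoint relative to the outer centre; the derivative
    -- $-h\sin\alpha$ of each summand is a difference of consecutive values of `D`.
    let D : ℝ → ℝ := fun y => R * cos (startAngle r δ R (A y)) / 2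
    have h1 : ∀ i ∈ Finset.range N, HasDerivAt (fun x => cos (A (x + i * κ)))
        (D (x + (i + 1 : ℕ) * κ) - D (x + i * κ)) x := by
      intro i _
      have h2 := (hA3 (x + i * κ)).comp_add_const x (i * κ)
      have h3 := h2.cos
      refine h3.congr_deriv ?_
      simp only [D]
      rw [show x + (i + 1 : ℕ) * κ = x + i * κ + κ by push_cast; ring, hnext,
        radius_mul_cos_endAngle hr hR, radius_mul_cos_startAngle hr hR]
      ring
    have h2 := HasDerivAt.fun_sum h1
    rw [Finset.sum_range_sub (fun i : ℕ => D (x + i * κ))] at h2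
    refine h2.congr_deriv ?_
    have h3 : x + (N : ℕ) * κ = x + (-(∑ j, n j) : ℤ) * Ω := by push_cast at hclose ⊢; linarith
    simp only [D]
    rw [h3, hAper, startAngle_add_int_mul, cos_add_int_mul_two_pi]
    simp
  rw [hsum]
  exact is_const_of_deriv_eq_zero (fun x => (hderiv x).differentiableAt)
    (fun x => (hderiv x).deriv) _ 0

end Poncelet

/-! ### Coordinates for conics, poles, tangent lines and inversion -/

/-- The ellipse (or circle) with centre `(s, 0)` and semi-axes `A`, `B`. -/
def conic (s A B : ℝ) : Set Plane := {p | (p 0 - s) ^ 2 / A ^ 2 + p 1 ^ 2 / B ^ 2 = 1}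

theorem ellipse_eq_conic (a b : ℝ) : ellipse a b = conic 0 a b := by
  simp [ellipse, conic]

theorem mem_conic {s A B : ℝ} (hA : 0 < A) (hB : 0 < B) {p : Plane} :
    p ∈ conic s A B ↔ B ^ 2 * (p 0 - s) ^ 2 + A ^ 2 * p 1 ^ 2 = A ^ 2 * B ^ 2 := by
  rw [conic, Set.mem_ofPred_eq, div_add_div _ _ (by positivity) (by positivity),
    div_eq_one_iff_eq (by positivity)]
  constructor <;> intro h <;> linarith

theorem mem_sphere_iff {c x : Plane} {s : ℝ} (hs : 0 ≤ s) :
    x ∈ Metric.sphere c s ↔ (x 0 - c 0) ^ 2 + (x 1 - c 1) ^ 2 = s ^ 2 := by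
  rw [Metric.mem_sphere, EuclideanSpace.dist_eq, Fin.sum_univ_two,
    Real.sqrt_eq_iff_eq_sq (by positivity) hs]
  simp [Real.dist_eq, sq_abs]

theorem sphere_eq_conic (s : ℝ) {r : ℝ} (hr : 0 < r) :
    Metric.sphere (!₂[s, 0] : Plane) r = conic s r r := by
  ext x
  rw [mem_sphere_iff hr.le, mem_conic hr hr]
  simp only [Matrix.cons_val_zero, Matrix.cons_val_one]
  have : r ^ 2 ≠ 0 := by positivity
  constructor
  · intro h; linear_combination r ^ 2 * h
  · intro h; apply mul_left_cancel₀ this; linear_combination h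

theorem plane_ext {p q : Plane} (h0 : p 0 = q 0) (h1 : p 1 = q 1) : p = q := by
  ext i
  fin_cases i
  · exact h0
  · exact h1

theorem inner_eq (x y : Plane) : inner ℝ x y = x 0 * y 0 + x 1 * y 1 := by
  rw [PiLp.inner_apply, Fin.sum_univ_two]
  simp [mul_comm]

theorem normSq_eq (x : Plane) : ‖x‖ ^ 2 = x 0 ^ 2 + x 1 ^ 2 := by
  rw [← real_inner_self_eq_norm_sq, inner_eq]; ring

theorem normSq_sub_pos {p q : Plane} (h : p ≠ q) :
    0 < (p 0 - q 0) ^ 2 + (p 1 - q 1) ^ 2 := by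
  have := norm_pos_iff.2 (sub_ne_zero.2 h)
  have h2 := normSq_eq (p - q)
  simp only [PiLp.sub_apply] at h2
  rw [← h2]; positivity

theorem inversion_apply (f : Plane) (ρ : ℝ) (q : Plane) (i : Fin 2) :
    inversion f ρ q i = ρ ^ 2 / ((q 0 - f 0) ^ 2 + (q 1 - f 1) ^ 2) * (q i - f i) + f i := by
  rw [inversion_def]
  have h2 := normSq_eq (q - f)
  simp only [PiLp.sub_apply] at h2
  simp [dist_eq_norm, div_pow, h2]

variable {f q : Plane} {ρ : ℝ}

theorem mem_polarLine (hq : q ≠ f) (x : Plane) :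
    x ∈ polarLine f ρ q ↔
      (x 0 - f 0) * (q 0 - f 0) + (x 1 - f 1) * (q 1 - f 1) = ρ ^ 2 := by
  have h := (normSq_sub_pos hq).ne'
  rw [polarLine, AffineSubspace.mem_mk', Submodule.mem_orthogonal_singleton_iff_inner_right,
    inner_eq]
  simp only [vsub_eq_sub, PiLp.sub_apply, inversion_apply]
  have e : (q 0 - f 0) * (x 0 - (ρ ^ 2 / ((q 0 - f 0) ^ 2 + (q 1 - f 1) ^ 2) * (q 0 - f 0) + f 0)) +
      (q 1 - f 1) * (x 1 - (ρ ^ 2 / ((q 0 - f 0) ^ 2 + (q 1 - f 1) ^ 2) * (q 1 - f 1) + f 1)) =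
      (x 0 - f 0) * (q 0 - f 0) + (x 1 - f 1) * (q 1 - f 1) - ρ ^ 2 := by
    field_simp
    ring
  rw [e, sub_eq_zero]

/-- Reciprocity of the polarity: the incidence $\langle p-f,q-f\rangle=\rho^2$ is symmetric. -/
theorem mem_polarLine_comm {p : Plane} (hq : q ≠ f) (hp : p ≠ f) :
    p ∈ polarLine f ρ q ↔ q ∈ polarLine f ρ p := by
  rw [mem_polarLine hq, mem_polarLine hp]
  simp only [mul_comm]

theorem finrank_polarLine (hq : q ≠ f) :
    Module.finrank ℝ (polarLine f ρ q).direction = 1 := by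
  have : Fact (Module.finrank ℝ Plane = 1 + 1) := ⟨by simp⟩
  rw [polarLine, AffineSubspace.direction_mk']
  exact Submodule.finrank_orthogonal_span_singleton (sub_ne_zero.2 hq)

theorem line_eq_of_mem {L : AffineSubspace ℝ Plane} (hL : Module.finrank ℝ L.direction = 1)
    {A B : Plane} (hAB : A ≠ B) (hA : A ∈ L) (hB : B ∈ L) : line[ℝ, A, B] = L := by
  have hle : line[ℝ, A, B] ≤ L := affineSpan_pair_le_of_mem_of_mem hA hB
  refine AffineSubspace.eq_of_direction_eq_of_nonempty_of_le ?_
    ⟨A, left_mem_affineSpan_pair ℝ A B⟩ hle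
  refine Submodule.eq_of_le_of_finrank_eq (AffineSubspace.direction_le hle) ?_
  rw [hL, direction_affineSpan, vectorSpan_pair_rev]
  exact finrank_span_singleton (sub_ne_zero.2 hAB.symm)

theorem ne_of_finrank_line {A B : Plane}
    (h : Module.finrank ℝ (line[ℝ, A, B]).direction = 1) : A ≠ B := by
  rintro rfl
  rw [direction_affineSpan, vectorSpan_pair_rev, vsub_self, Submodule.span_zero_singleton,
    finrank_bot] at h
  exact zero_ne_one h

theorem line_eq_polarLine {A B : Plane} (hq : q ≠ f) (hAB : A ≠ B)
    (hA : A ∈ polarLine f ρ q) (hB : B ∈ polarLine f ρ q) : line[ℝ, A, B] = polarLine f ρ q :=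
  line_eq_of_mem (finrank_polarLine hq) hAB hA hB

theorem exists_isPole (hρ : 0 < ρ) {A B : Plane} (hAB : A ≠ B) (hf : f ∉ line[ℝ, A, B]) :
    ∃ q, IsPole f ρ q line[ℝ, A, B] := by
  have hd := normSq_sub_pos hAB
  -- Twice the signed area of the triangle $fAB$. It vanishes only if `f` is on the line; the pole
  -- is `f` plus the normal of the line scaled by $\rho^2/c$.
  set c := (A 0 - f 0) * (B 1 - A 1) - (A 1 - f 1) * (B 0 - A 0) with hc
  have hc0 : c ≠ 0 := by
    intro h0
    apply hf
    have : f = AffineMap.lineMap A B (((f 0 - A 0) * (B 0 - A 0) + (f 1 - A 1) * (B 1 - A 1)) /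
        ((A 0 - B 0) ^ 2 + (A 1 - B 1) ^ 2)) := by
      rw [AffineMap.lineMap_apply]
      apply plane_ext
      · simp
        field_simp
        linear_combination (B 1 - A 1) * (hc - h0)
      · simp
        field_simp
        linear_combination -(B 0 - A 0) * (hc - h0)
    rw [this]
    exact AffineMap.lineMap_mem_affineSpan_pair _ _ _
  have hqf : (!₂[f 0 + ρ ^ 2 / c * (B 1 - A 1), f 1 - ρ ^ 2 / c * (B 0 - A 0)] : Plane) ≠ f := by
    intro h
    have h0 := congrArg (fun p : Plane => p 0) h
    have h1 := congrArg (fun p : Plane => p 1) h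
    simp [hc0, hρ.ne'] at h0 h1
    apply hc0
    rw [hc, h0, h1]
    ring
  refine ⟨_, hqf, line_eq_polarLine hqf hAB ?_ ?_⟩
  · rw [mem_polarLine hqf]
    simp
    field_simp
    linear_combination -hc
  · rw [mem_polarLine hqf]
    simp
    field_simp
    linear_combination -hc

/-- A line `u (x - s) + v y = p` meets the conic in exactly one point iff `p` is the support
function of the conic. -/
theorem existsUnique_mem_conic_iff {s A B u v p : ℝ} (hA : 0 < A) (hB : 0 < B)
    (huv : 0 < u ^ 2 + v ^ 2) :
    (∃! x : Plane, x ∈ conic s A B ∧ u * (x 0 - s) + v * x 1 = p) ↔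
      p ^ 2 = A ^ 2 * u ^ 2 + B ^ 2 * v ^ 2 := by
  simp only [mem_conic hA hB]
  constructor
  · rintro ⟨x, ⟨hx1, hx2⟩, hun⟩
    have hq : 0 < B ^ 2 * v ^ 2 + A ^ 2 * u ^ 2 := by
      rcases eq_or_ne u 0 with rfl | hu
      · have : 0 < v ^ 2 := by simpa using huv
        positivity
      · positivity
    -- Half the derivative of the quadratic form along the line, in direction $(-v,u)$. The line
    -- meets the conic again at parameter `t`, so uniqueness forces $w=0$. The result then follows
    -- from $(A^2u^2+B^2v^2)(B^2X^2+A^2Y^2)=A^2B^2(uX+vY)^2+w^2$ with $X=x_0-s$, $Y=x_1$.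
    set w := A ^ 2 * u * x 1 - B ^ 2 * v * (x 0 - s) with hw
    set t := -2 * w / (B ^ 2 * v ^ 2 + A ^ 2 * u ^ 2) with ht
    have ht' : t * (B ^ 2 * v ^ 2 + A ^ 2 * u ^ 2) = -2 * w := by
      rw [ht]; field_simp
    have hy := hun !₂[x 0 - t * v, x 1 + t * u] (by
      simp
      constructor
      · linear_combination hx1 + t * ht' + 2 * t * hw
      · linear_combination hx2)
    have h0 := congrArg (fun p : Plane => p 0) hy
    have h1 := congrArg (fun p : Plane => p 1) hy
    simp at h0 h1
    have ht0 : t = 0 := by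
      rcases h0 with h | h
      · exact h
      · rcases h1 with h' | h'
        · exact h'
        · simp [h, h'] at huv
    have hw0 : w = 0 := by rw [ht0] at ht'; linarith
    have h3 : A ^ 2 * B ^ 2 * (p ^ 2 - (A ^ 2 * u ^ 2 + B ^ 2 * v ^ 2)) = 0 := by
      rw [← hx2]
      linear_combination -w * hw0 + (A ^ 2 * u ^ 2 + B ^ 2 * v ^ 2) * hx1 -
        (w + (A ^ 2 * u * x 1 - B ^ 2 * v * (x 0 - s))) * hw + 2 * w * hw
    have h4 : A ^ 2 * B ^ 2 ≠ 0 := by positivity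
    have := (mul_eq_zero.1 h3).resolve_left h4
    linarith
  · intro hp
    have hp0 : p ≠ 0 := by
      rintro rfl
      rcases eq_or_ne u 0 with rfl | hu
      · have : 0 < v ^ 2 := by simpa using huv
        have : 0 < B ^ 2 * v ^ 2 := by positivity
        nlinarith
      · have : 0 < A ^ 2 * u ^ 2 := by positivity
        nlinarith [sq_nonneg (B * v)]
    refine ⟨!₂[s + A ^ 2 * u / p, B ^ 2 * v / p], ⟨?_, ?_⟩, ?_⟩
    · simp
      field_simp
      linear_combination -hp
    · simp
      field_simp
      linear_combination -hp
    · rintro y ⟨hy1, hy2⟩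
      have hw : A ^ 2 * u * y 1 - B ^ 2 * v * (y 0 - s) = 0 := by
        have : (A ^ 2 * u * y 1 - B ^ 2 * v * (y 0 - s)) ^ 2 = 0 := by
          rw [← hy2] at hp
          linear_combination (A ^ 2 * u ^ 2 + B ^ 2 * v ^ 2) * hy1 - A ^ 2 * B ^ 2 * hp
        exact pow_eq_zero_iff (two_ne_zero) |>.1 this
      have hB2 : B ^ 2 ≠ 0 := by positivity
      have hA2 : A ^ 2 ≠ 0 := by positivity
      apply plane_ext
      · simp
        rw [← sub_eq_iff_eq_add', eq_div_iff hp0]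
        apply mul_left_cancel₀ hB2
        linear_combination u * hy1 - (y 1) * hw - B ^ 2 * (y 0 - s) * hy2
      · simp
        rw [eq_div_iff hp0]
        apply mul_left_cancel₀ hA2
        linear_combination v * hy1 + (y 0 - s) * hw - A ^ 2 * (y 1) * hy2

/-- The support function criterion applied to the polar line rewritten around the centre $(s,0)$:
the normal is $q-f$ and the offset $\rho^2+(f_0-s)(q_0-f_0)$. -/
theorem isTangentLine_polarLine_iff {s A B : ℝ} (hA : 0 < A) (hB : 0 < B) (hf : f 1 = 0)
    (hq : q ≠ f) :
    IsTangentLine (conic s A B) (polarLine f ρ q) ↔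
      (ρ ^ 2 + (f 0 - s) * (q 0 - f 0)) ^ 2 =
        A ^ 2 * (q 0 - f 0) ^ 2 + B ^ 2 * q 1 ^ 2 := by
  have h1 := normSq_sub_pos hq
  rw [hf, sub_zero] at h1
  rw [← existsUnique_mem_conic_iff (s := s) hA hB h1, IsTangentLine,
    and_iff_right (finrank_polarLine hq)]
  apply existsUnique_congr
  intro x
  rw [mem_polarLine hq, hf]
  refine and_congr_right fun _ => ?_
  constructor <;> intro h <;> linear_combination h

/-- A tangent line avoids the interior points of the conic. -/
theorem notMem_of_isTangentLine {s A B : ℝ} (hA : 0 < A) (hB : 0 < B)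
    {L : AffineSubspace ℝ Plane} (hL : IsTangentLine (conic s A B) L)
    (hf : B ^ 2 * (f 0 - s) ^ 2 + A ^ 2 * f 1 ^ 2 < A ^ 2 * B ^ 2) : f ∉ L := by
  intro hfL
  obtain ⟨x, ⟨hx, hxL⟩, hun⟩ := hL.2
  rw [mem_conic hA hB] at hx
  have hxf : x ≠ f := by
    rintro rfl
    linarith
  have hd := normSq_sub_pos hxf
  set g := B ^ 2 * (x 0 - f 0) ^ 2 + A ^ 2 * (x 1 - f 1) ^ 2 with hg
  have hg0 : 0 < g := by
    by_contra hcon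
    have h0 : 0 ≤ (B * (x 0 - f 0)) ^ 2 := sq_nonneg _
    have h1 : 0 ≤ (A * (x 1 - f 1)) ^ 2 := sq_nonneg _
    have h2 : (B * (x 0 - f 0)) ^ 2 = 0 := by nlinarith
    have h3 : (A * (x 1 - f 1)) ^ 2 = 0 := by nlinarith
    have h4 : x 0 - f 0 = 0 := by simpa [hB.ne'] using h2
    have h5 : x 1 - f 1 = 0 := by simpa [hA.ne'] using h3
    rw [h4, h5] at hd
    simp at hd
  set e := B ^ 2 * (f 0 - s) ^ 2 + A ^ 2 * f 1 ^ 2 - A ^ 2 * B ^ 2 with he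
  have he0 : e < 0 := by linarith
  -- On the line from `f` (parameter $0$) to `x` (parameter $1$) the conic is a quadratic with
  -- product of roots $e/g$, so `e / g` is the other root. It is negative, giving a second
  -- intersection.
  have ht : e / g < 0 := div_neg_of_neg_of_pos he0 hg0
  set t := e / g with htd
  have htg : t * g = e := by rw [htd]; field_simp
  have hy : AffineMap.lineMap f x t = x := by
    refine hun _ ⟨?_, AffineMap.lineMap_mem t hfL hxL⟩
    rw [mem_conic hA hB, AffineMap.lineMap_apply]
    simp
    linear_combination (t - 1) * htg + t * hx + t * hg - t ^ 2 * hg + (1 - t) * he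
  rw [AffineMap.lineMap_apply] at hy
  have h0 := congrArg (fun p : Plane => p 0) hy
  have h1 := congrArg (fun p : Plane => p 1) hy
  simp at h0 h1
  have h2 : (t - 1) * (x 0 - f 0) = 0 := by linarith
  have h3 : (t - 1) * (x 1 - f 1) = 0 := by linarith
  have h4 : t - 1 ≠ 0 := by linarith
  rw [(mul_eq_zero.1 h2).resolve_left h4, (mul_eq_zero.1 h3).resolve_left h4] at hd
  simp at hd

/-- A line meets a conic in at most two points. -/
theorem eq_of_mem_conic_of_mem_polarLine {s A B : ℝ} (hA : 0 < A) (hB : 0 < B) (hq : q ≠ f)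
    {x y z : Plane} (hx : x ∈ conic s A B) (hy : y ∈ conic s A B) (hz : z ∈ conic s A B)
    (hx' : x ∈ polarLine f ρ q) (hy' : y ∈ polarLine f ρ q) (hz' : z ∈ polarLine f ρ q)
    (hxy : x ≠ y) (hyz : y ≠ z) : x = z := by
  rw [mem_conic hA hB] at hx hy hz
  rw [mem_polarLine hq] at hx' hy' hz'
  have hv := normSq_sub_pos hq
  set v := q 0 - f 0
  set w := q 1 - f 1
  have param : ∀ {x y : Plane},
      (x 0 - f 0) * v + (x 1 - f 1) * w = ρ ^ 2 → (y 0 - f 0) * v + (y 1 - f 1) * w = ρ ^ 2 →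
      ∃ t, x 0 = y 0 - t * w ∧ x 1 = y 1 + t * v := by
    intro x y hx hy
    refine ⟨((x 1 - y 1) * v - (x 0 - y 0) * w) / (v ^ 2 + w ^ 2), ?_, ?_⟩
    · field_simp
      linear_combination v * (hx - hy)
    · field_simp
      linear_combination w * (hx - hy)
  obtain ⟨t, ht0, ht1⟩ := param hx' hy'
  obtain ⟨t', ht0', ht1'⟩ := param hz' hy'
  have htn : t ≠ 0 := by
    rintro rfl
    exact hxy (plane_ext (by simpa using ht0) (by simpa using ht1))
  have htn' : t' ≠ 0 := by
    rintro rfl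
    exact hyz (plane_ext (by simpa using ht0'.symm) (by simpa using ht1'.symm))
  rw [ht0, ht1] at hx
  rw [ht0', ht1'] at hz
  -- With `y` at parameter $0$, dividing out the known root leaves a linear equation, the same for
  -- `t` and `t'`.
  have e1 : t * (B ^ 2 * w ^ 2 + A ^ 2 * v ^ 2) + 2 * (A ^ 2 * y 1 * v - B ^ 2 * (y 0 - s) * w)
      = 0 := by
    apply mul_left_cancel₀ htn
    linear_combination hx - hy
  have e2 : t' * (B ^ 2 * w ^ 2 + A ^ 2 * v ^ 2) + 2 * (A ^ 2 * y 1 * v - B ^ 2 * (y 0 - s) * w)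
      = 0 := by
    apply mul_left_cancel₀ htn'
    linear_combination hz - hy
  have hq : B ^ 2 * w ^ 2 + A ^ 2 * v ^ 2 ≠ 0 := by
    rcases eq_or_ne v 0 with h | h
    · have : 0 < w ^ 2 := by simpa [h] using hv
      positivity
    · positivity
  have : t = t' := mul_right_cancel₀ hq (by linarith)
  exact plane_ext (by rw [ht0, ht0', this]) (by rw [ht1, ht1', this])

/-- The foot of the perpendicular from the centre to a polar line is the inverse of the pole. -/
theorem pedal_eq_inversion {N : ℕ} {Q : Polygon N} {j : ZMod N} {p : Plane}
    (h : sideline Q j = polarLine f ρ p) : pedal f Q j = inversion f ρ p := by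
  rw [pedal, coe_orthogonalProjection_eq_iff_mem, h, polarLine, AffineSubspace.direction_mk',
    Submodule.orthogonal_orthogonal]
  refine ⟨AffineSubspace.self_mem_mk' _ _, ?_⟩
  rw [← neg_mem_iff, neg_vsub_eq_vsub_rev, inversion_vsub_center]
  exact Submodule.smul_mem _ _ (Submodule.mem_span_singleton_self _)

/-- The inversion in a circle centred at `f` maps the circle `|y|² - 2 m y₀ = w` (in coordinates
centred at `f`) to a circle whose centre depends on `m / w` only. -/
theorem inversion_image_sphere {m r w k : ℝ} (hk : 0 < k) (hr : 0 < r)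
    (hw : w = r ^ 2 - m ^ 2) (hw0 : 0 < w) (hf : f 1 = 0) :
    inversion f k '' Metric.sphere (!₂[f 0 + m, 0] : Plane) r =
      Metric.sphere (!₂[f 0 - m / w * k ^ 2, 0] : Plane) (k ^ 2 * r / w) := by
  have hinv := inversion_involutive f hk.ne'
  rw [hinv.image_eq_preimage_symm]
  ext z
  rw [Set.mem_preimage, mem_sphere_iff hr.le, mem_sphere_iff (by positivity)]
  simp only [Matrix.cons_val_zero, Matrix.cons_val_one, sub_zero]
  -- `inversion` fixes its centre by convention, so $z=f$ needs a separate check: `f` is on neither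
  -- circle because $w\ne0$.
  rcases eq_or_ne z f with rfl | hz
  · rw [inversion_self, hf]
    constructor
    · intro h; nlinarith
    · intro h
      field_simp at h
      have h1 : k ^ 4 * w = 0 := by rw [hw]; linear_combination -h
      exact absurd h1 (by positivity)
  · have hd := (normSq_sub_pos hz).ne'
    have hd2 := normSq_sub_pos hz
    rw [inversion_apply, inversion_apply, hf]
    rw [hf] at hd hd2
    simp only [sub_zero] at hd hd2 ⊢
    set y := z 0 - f 0 with hy
    have hzy : z 0 = f 0 + y := by rw [hy]; ring
    rw [hzy]
    have hk4 : 0 < k ^ 4 := by positivity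
    have e1 : (k ^ 2 / (y ^ 2 + z 1 ^ 2) * y + f 0 - (f 0 + m)) ^ 2 +
        (k ^ 2 / (y ^ 2 + z 1 ^ 2) * z 1 + 0) ^ 2 - r ^ 2 =
        (k ^ 4 - 2 * m * k ^ 2 * y - w * (y ^ 2 + z 1 ^ 2)) / (y ^ 2 + z 1 ^ 2) := by
      rw [hw]
      field_simp
      ring
    have e2 : (f 0 + y - (f 0 - m / w * k ^ 2)) ^ 2 + z 1 ^ 2 - (k ^ 2 * r / w) ^ 2 =
        -(k ^ 4 - 2 * m * k ^ 2 * y - w * (y ^ 2 + z 1 ^ 2)) / w := by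
      field_simp
      linear_combination k ^ 4 * hw
    rw [← sub_eq_zero, e1, ← sub_eq_zero (b := (k ^ 2 * r / w) ^ 2), e2, div_eq_zero_iff,
      div_eq_zero_iff, neg_eq_zero]
    simp [hd, hw0.ne']

/-! ### Weill's theorem for unoriented polygons, and the side lengths of pedal polygons -/

section Weill

open Real

/-- The signed distance from the midpoint of the chord, measured along the tangent, has square
$h^2$; its sign selects the endpoint. -/
theorem endpoint_of_mem_tangent {r δ R α x y : ℝ} (hr : 0 < r) (hR : r + |δ| < R)
    (ht : x * cos α + y * sin α = r) (hc : (x - δ) ^ 2 + y ^ 2 = R ^ 2) :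
    (x - δ = R * cos (endAngle r δ R α) ∧ y = R * sin (endAngle r δ R α)) ∨
      (x - δ = R * cos (startAngle r δ R α) ∧ y = R * sin (startAngle r δ R α)) := by
  rw [radius_mul_cos_endAngle hr hR, radius_mul_cos_startAngle hr hR,
    radius_mul_sin_endAngle hr hR, radius_mul_sin_startAngle hr hR]
  have h1 := sq_halfChord hr hR α
  have h2 := sin_sq_add_cos_sq α
  have h3 : (y * cos α - (x - δ) * sin α) ^ 2 = halfChord r δ R α ^ 2 := by
    rw [h1, ← hc, ← ht]
    linear_combination ((x - δ) ^ 2 + y ^ 2) * h2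
  rcases sq_eq_sq_iff_eq_or_eq_neg.1 h3 with h | h
  · left
    constructor
    · linear_combination cos α * ht - sin α * h - (x - δ) * h2
    · linear_combination sin α * ht + cos α * h - y * h2
  · right
    constructor
    · linear_combination cos α * ht - sin α * h - (x - δ) * h2
    · linear_combination sin α * ht + cos α * h - y * h2

/-- Weill's theorem for closed polygons of either orientation that are inscribed in the circle of
radius `R` about `(δ, 0)` and circumscribed about the circle of radius `r` about the origin. -/
theorem exists_sum_cos_eq_of_tangent_polygon {r δ R : ℝ} (hr : 0 < r) (hR : r + |δ| < R) (N : ℕ)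
    [NeZero N] :
    ∃ S₀ : ℝ, ∀ (α : ZMod N → ℝ) (x y : ZMod N → ℝ),
      (∀ j, (x j - δ) ^ 2 + y j ^ 2 = R ^ 2) →
      (∀ j, x j * cos (α j) + y j * sin (α j) = r) →
      (∀ j, x (j - 1) * cos (α j) + y (j - 1) * sin (α j) = r) →
      (∀ j, ¬ (x (j - 1) = x j ∧ y (j - 1) = y j)) →
      (∀ j, ¬ (cos (α j) = cos (α (j + 1)) ∧ sin (α j) = sin (α (j + 1)))) →
      ∑ j, cos (α j) = S₀ := by
  obtain ⟨S₀, hS⟩ := exists_sum_cos_contactAngle_eq hr hR N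
  refine ⟨S₀, fun α x y hc ht ht' hxy hα => ?_⟩
  have hR0 := (radius_pos hr hR).ne'
  let E : ℝ → ZMod N → Prop := fun α j =>
    x j - δ = R * cos (endAngle r δ R α) ∧ y j = R * sin (endAngle r δ R α)
  let S : ℝ → ZMod N → Prop := fun α j =>
    x j - δ = R * cos (startAngle r δ R α) ∧ y j = R * sin (startAngle r δ R α)
  have hES : ∀ j, (E (α j) j ∧ S (α j) (j - 1)) ∨ (S (α j) j ∧ E (α j) (j - 1)) := by
    intro j
    rcases endpoint_of_mem_tangent hr hR (ht j) (hc j) with h | h <;>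
      rcases endpoint_of_mem_tangent hr hR (ht' j) (hc (j - 1)) with h' | h'
    · exact absurd ⟨by linarith [h.1, h'.1], by linarith [h.2, h'.2]⟩ (hxy j)
    · exact Or.inl ⟨h, h'⟩
    · exact Or.inr ⟨h, h'⟩
    · exact absurd ⟨by linarith [h.1, h'.1], by linarith [h.2, h'.2]⟩ (hxy j)
  -- The orientation cannot switch at a vertex: if both sides had it as final endpoint, they would
  -- be the same chord. So the whole polygon is traversed one way, and in the other orientation the
  -- indices are negated.
  have hstep : ∀ j, E (α j) j → S (α (j + 1)) j ∧ E (α (j + 1)) (j + 1) := by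
    intro j hj
    rcases hES (j + 1) with h | h
    · rw [add_sub_cancel_right] at h
      exact h.symm
    · rw [add_sub_cancel_right] at h
      exact absurd (cos_sin_eq_of_endAngle hr hR
        (mul_left_cancel₀ hR0 (hj.1.symm.trans h.2.1))
        (mul_left_cancel₀ hR0 (hj.2.symm.trans h.2.2))) (hα j)
  by_cases hex : ∃ j, E (α j) j
  · obtain ⟨j₀, hj₀⟩ := hex
    have hall : ∀ n : ℕ, E (α (j₀ + n)) (j₀ + n) := by
      intro n
      induction n with
      | zero => simpa using hj₀
      | succ n ih =>
        have := (hstep _ ih).2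
        rw [add_assoc] at this
        exact_mod_cast this
    apply hS
    intro j
    have hj := hall (j - j₀).val
    rw [ZMod.natCast_zmod_val, add_sub_cancel] at hj
    have hj' := (hstep j hj).1
    exact ⟨mul_left_cancel₀ hR0 (hj.1.symm.trans hj'.1),
      mul_left_cancel₀ hR0 (hj.2.symm.trans hj'.2)⟩
  · have hall : ∀ j, S (α j) j ∧ E (α j) (j - 1) := fun j =>
      (hES j).resolve_left fun h => hex ⟨j, h.1⟩
    rw [← Equiv.sum_comp (Equiv.neg (ZMod N))]
    apply hS fun j => α (-j)
    intro j
    have h1 := (hall (-j)).2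
    have h2 := (hall (-(j + 1))).1
    rw [show -(j + 1) = -j - 1 by ring] at h2
    rw [show -(j + 1) = -j - 1 by ring]
    exact ⟨mul_left_cancel₀ hR0 (h1.1.symm.trans h2.1),
      mul_left_cancel₀ hR0 (h1.2.symm.trans h2.2)⟩

/-- The intersection of the tangents with normals `(c, s)` and `(c', s')`. -/
theorem tangents_inter {r x y c s c' s' : ℝ} (hr : 0 < r) (h1 : c ^ 2 + s ^ 2 = 1)
    (h2 : c' ^ 2 + s' ^ 2 = 1) (ht : x * c + y * s = r) (ht' : x * c' + y * s' = r)
    (hne : ¬ (c = c' ∧ s = s')) :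
    (1 + (c * c' + s * s')) * x = r * (c + c') ∧ (1 + (c * c' + s * s')) * y = r * (s + s') ∧
      0 < 1 + (c * c' + s * s') := by
  have hcross : x * (s + s') - y * (c + c') = 0 := by
    rcases eq_or_ne c c' with h | h
    · have hs : s - s' ≠ 0 := sub_ne_zero.2 fun h' => hne ⟨h, h'⟩
      apply mul_left_cancel₀ hs
      linear_combination x * (h1 - h2) - (c + c') * (ht - ht')
    · apply mul_left_cancel₀ (sub_ne_zero.2 h)
      linear_combination (s + s') * (ht - ht') - y * (h1 - h2)
  have e0 : (1 + (c * c' + s * s')) * x = r * (c + c') := by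
    linear_combination (s + s') / 2 * hcross + (c + c') / 2 * (ht + ht') - x / 2 * (h1 + h2)
  have e1 : (1 + (c * c' + s * s')) * y = r * (s + s') := by
    linear_combination -(c + c') / 2 * hcross + (s + s') / 2 * (ht + ht') - y / 2 * (h1 + h2)
  refine ⟨e0, e1, lt_of_le_of_ne (by nlinarith [sq_nonneg (c + c'), sq_nonneg (s + s')]) ?_⟩
  intro h0
  rw [← h0, zero_mul] at e0 e1
  have h3 : c + c' = 0 := by simpa [hr.ne'] using e0.symm
  have h4 : s + s' = 0 := by simpa [hr.ne'] using e1.symm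
  have : 2 * r = 0 := by linear_combination x * h3 + y * h4 - ht - ht'
  linarith

/-- The distance of the feet of the perpendiculars from `(-m, 0)` to the two tangents of the circle
of radius `r` about the origin through a point `(x, y)`, for which the tangent length is `κ` times
the distance from `(-m, 0)`. -/
theorem dist_feet {r m δ R κ x y c s c' s' : ℝ} (hr : 0 < r) (hR : |δ| < R) (hκ : 0 < κ)
    (h1 : c ^ 2 + s ^ 2 = 1) (h2 : c' ^ 2 + s' ^ 2 = 1) (ht : x * c + y * s = r)
    (ht' : x * c' + y * s' = r) (hne : ¬ (c = c' ∧ s = s'))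
    (hc : (x - δ) ^ 2 + y ^ 2 = R ^ 2)
    (hκ' : κ ^ 2 * ((x + m) ^ 2 + y ^ 2) = x ^ 2 + y ^ 2 - r ^ 2) :
    √(((r + m * c) * c - (r + m * c') * c') ^ 2 + ((r + m * c) * s - (r + m * c') * s') ^ 2) =
      r / κ * (2 - 2 * r ^ 2 / (R ^ 2 - δ ^ 2)) +
        2 * δ * r ^ 2 / (κ * (R ^ 2 - δ ^ 2)) * (c + c') := by
  obtain ⟨e0, e1, hpos⟩ := tangents_inter hr h1 h2 ht ht' hne
  have hD : 0 < R ^ 2 - δ ^ 2 := by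
    have : |δ| ^ 2 < R ^ 2 := by
      have := abs_nonneg δ
      gcongr
    rw [sq_abs] at this
    linarith
  have hW : (1 + (c * c' + s * s')) * (x ^ 2 + y ^ 2) = 2 * r ^ 2 := by
    linear_combination x * e0 + y * e1 + r * (ht + ht')
  -- With $\theta$ the angle between the normals, the equation of the outer circle multiplied by
  -- $1+\cos\theta$ becomes linear in $c+c'$.
  have hlin : (R ^ 2 - δ ^ 2) * (1 + (c * c' + s * s')) = 2 * r ^ 2 - 2 * δ * r * (c + c') := by
    linear_combination hW - 2 * δ * e0 - (1 + (c * c' + s * s')) * hc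
  have hle : c * c' + s * s' ≤ 1 := by nlinarith [sq_nonneg (c - c'), sq_nonneg (s - s')]
  have hval : r / κ * (2 - 2 * r ^ 2 / (R ^ 2 - δ ^ 2)) +
      2 * δ * r ^ 2 / (κ * (R ^ 2 - δ ^ 2)) * (c + c') = r / κ * (1 - (c * c' + s * s')) := by
    field_simp
    linear_combination hlin
  rw [hval, Real.sqrt_eq_iff_eq_sq (by positivity)
    (mul_nonneg (by positivity) (by linarith))]
  have hp : r + m * c = (x + m) * c + y * s := by linear_combination -ht
  have hp' : r + m * c' = (x + m) * c' + y * s' := by linear_combination -ht'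
  -- Both feet lie on the circle whose diameter joins $(-m,0)$ to $(x,y)$, so their distance is that
  -- diameter times $|\sin\theta|$.
  have hdist : ((r + m * c) * c - (r + m * c') * c') ^ 2 +
      ((r + m * c) * s - (r + m * c') * s') ^ 2 =
      ((x + m) ^ 2 + y ^ 2) * (1 - (c * c' + s * s') ^ 2) := by
    have e3 : ((r + m * c) * c - (r + m * c') * c') ^ 2 +
      ((r + m * c) * s - (r + m * c') * s') ^ 2 = (r + m * c) ^ 2 + (r + m * c') ^ 2 -
        2 * (r + m * c) * (r + m * c') * (c * c' + s * s') := by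
      linear_combination (r + m * c) ^ 2 * h1 + (r + m * c') ^ 2 * h2
    rw [e3, hp, hp']
    have e4 : (c * c' + s * s') ^ 2 + (c * s' - s * c') ^ 2 = 1 := by
      linear_combination (c' ^ 2 + s' ^ 2) * h1 + h2
    linear_combination ((x + m) ^ 2 + y ^ 2) * e4 - ((x + m) * c + y * s) ^ 2 * h2 -
      ((x + m) * c' + y * s') ^ 2 * h1
  rw [hdist]
  field_simp
  have hpos' := hpos.ne'
  apply mul_left_cancel₀ hpos'
  linear_combination (1 + (c * c' + s * s')) * (1 - (c * c' + s * s') ^ 2) * hκ' +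
    (1 - (c * c' + s * s') ^ 2) * hW

end Weill

/-! ### Focal polarity between ellipses and circles -/

/-- The polar image of `ellipse a b` with respect to the circle of radius `ρ` about its focus
`f`. -/
def polarCircle (f : Plane) (ρ a b : ℝ) : Sphere Plane :=
  ⟨!₂[f 0 + f 0 * ρ ^ 2 / b ^ 2, 0], ρ ^ 2 * a / b ^ 2⟩

section Polarity

variable {f : Plane} {ρ a b : ℝ}

theorem coe_polarCircle (ha : 0 < a) (hb : 0 < b) (hρ : 0 < ρ) :
    (polarCircle f ρ a b : Set Plane) =
      conic (f 0 + f 0 * ρ ^ 2 / b ^ 2) (ρ ^ 2 * a / b ^ 2) (ρ ^ 2 * a / b ^ 2) :=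
  sphere_eq_conic _ (r := ρ ^ 2 * a / b ^ 2) (by positivity)

/-- In coordinates about `f` only the factor $b^2$ distinguishes the polar circles of confocal
ellipses. This makes `f` a limiting point and yields the constant ratio `κ` in the perimeter
computation. -/
theorem mem_polarCircle (ha : 0 < a) (hb : 0 < b) (hf0 : f 0 ^ 2 = a ^ 2 - b ^ 2) {q : Plane} :
    q ∈ (polarCircle f ρ a b : Set Plane) ↔
      b ^ 2 * ((q 0 - f 0) ^ 2 + q 1 ^ 2) = ρ ^ 4 + 2 * f 0 * ρ ^ 2 * (q 0 - f 0) := by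
  rw [polarCircle, mem_sphere_iff (by positivity)]
  simp only [Matrix.cons_val_zero, Matrix.cons_val_one, sub_zero]
  have e : (q 0 - (f 0 + f 0 * ρ ^ 2 / b ^ 2)) ^ 2 + q 1 ^ 2 - (ρ ^ 2 * a / b ^ 2) ^ 2 =
      (b ^ 2 * ((q 0 - f 0) ^ 2 + q 1 ^ 2) - (ρ ^ 4 + 2 * f 0 * ρ ^ 2 * (q 0 - f 0))) / b ^ 2 := by
    field_simp
    linear_combination ρ ^ 4 * hf0
  rw [← sub_eq_zero, e, div_eq_zero_iff, sub_eq_zero]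
  simp [hb.ne']

theorem focus_notMem_ellipse (ha : 0 < a) (hb : 0 < b) (hf0 : f 0 ^ 2 = a ^ 2 - b ^ 2)
    (hf1 : f 1 = 0) : f ∉ ellipse a b := by
  rw [ellipse_eq_conic, mem_conic ha hb, sub_zero, hf0, hf1]
  intro h
  have : b ^ 4 = 0 := by linear_combination -h
  exact absurd this (by positivity)

theorem focus_notMem_polarCircle (ha : 0 < a) (hb : 0 < b) (hρ : 0 < ρ)
    (hf0 : f 0 ^ 2 = a ^ 2 - b ^ 2) (hf1 : f 1 = 0) :
    f ∉ (polarCircle f ρ a b : Set Plane) := by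
  rw [mem_polarCircle ha hb hf0, hf1, sub_self]
  intro h
  have : ρ ^ 4 = 0 := by linear_combination -h
  exact absurd this (by positivity)

theorem isTangentLine_ellipse_polarLine_iff (ha : 0 < a) (hb : 0 < b)
    (hf0 : f 0 ^ 2 = a ^ 2 - b ^ 2) (hf1 : f 1 = 0) {q : Plane} (hq : q ≠ f) :
    IsTangentLine (ellipse a b) (polarLine f ρ q) ↔ q ∈ (polarCircle f ρ a b : Set Plane) := by
  rw [ellipse_eq_conic, isTangentLine_polarLine_iff ha hb hf1 hq, mem_polarCircle ha hb hf0]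
  constructor <;> intro h <;> linear_combination -h + (q 0 - f 0) ^ 2 * hf0

/-- The dual incidence: the tangency condition for the circle is the equation of the ellipse up to
the factor $-\rho^4/b^4$. -/
theorem isTangentLine_polarCircle_polarLine_iff (ha : 0 < a) (hb : 0 < b) (hρ : 0 < ρ)
    (hf0 : f 0 ^ 2 = a ^ 2 - b ^ 2) (hf1 : f 1 = 0) {p : Plane} (hp : p ≠ f) :
    IsTangentLine (polarCircle f ρ a b : Set Plane) (polarLine f ρ p) ↔ p ∈ ellipse a b := by
  have hr : 0 < ρ ^ 2 * a / b ^ 2 := by positivity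
  rw [coe_polarCircle ha hb hρ, isTangentLine_polarLine_iff hr hr hf1 hp, ellipse_eq_conic,
    mem_conic ha hb]
  have e : (ρ ^ 2 + (f 0 - (f 0 + f 0 * ρ ^ 2 / b ^ 2)) * (p 0 - f 0)) ^ 2 -
      ((ρ ^ 2 * a / b ^ 2) ^ 2 * (p 0 - f 0) ^ 2 + (ρ ^ 2 * a / b ^ 2) ^ 2 * p 1 ^ 2) =
      -(b ^ 2 * (p 0 - 0) ^ 2 + a ^ 2 * p 1 ^ 2 - a ^ 2 * b ^ 2) * (ρ ^ 4 / b ^ 4) := by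
    field_simp
    linear_combination ρ ^ 4 * ((p 0 - f 0) ^ 2 + b ^ 2) * hf0
  rw [← sub_eq_zero, e, mul_eq_zero, neg_eq_zero, sub_eq_zero]
  have : ρ ^ 4 / b ^ 4 ≠ 0 := by positivity
  simp [this]

theorem focus_notMem_of_isTangentLine_ellipse (ha : 0 < a) (hb : 0 < b)
    (hf0 : f 0 ^ 2 = a ^ 2 - b ^ 2) (hf1 : f 1 = 0) {L : AffineSubspace ℝ Plane}
    (hL : IsTangentLine (ellipse a b) L) : f ∉ L := by
  rw [ellipse_eq_conic] at hL
  apply notMem_of_isTangentLine ha hb hL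
  rw [sub_zero, hf0, hf1]
  have : 0 < b ^ 4 := by positivity
  nlinarith

theorem focus_notMem_of_isTangentLine_polarCircle (ha : 0 < a) (hb : 0 < b) (hρ : 0 < ρ)
    (hf0 : f 0 ^ 2 = a ^ 2 - b ^ 2) (hf1 : f 1 = 0) {L : AffineSubspace ℝ Plane}
    (hL : IsTangentLine (polarCircle f ρ a b : Set Plane) L) : f ∉ L := by
  have hr : 0 < ρ ^ 2 * a / b ^ 2 := by positivity
  rw [coe_polarCircle ha hb hρ] at hL
  apply notMem_of_isTangentLine hr hr hL
  rw [hf1]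
  have e : (ρ ^ 2 * a / b ^ 2) ^ 2 - (f 0 - (f 0 + f 0 * ρ ^ 2 / b ^ 2)) ^ 2 = ρ ^ 4 / b ^ 2 := by
    field_simp
    linear_combination -ρ ^ 4 * hf0
  have h1 : 0 < ρ ^ 4 / b ^ 2 := by positivity
  rw [← e] at h1
  nlinarith [mul_pos (pow_pos hr 2) h1]

theorem polarCurve_ellipse (ha : 0 < a) (hb : 0 < b) (hρ : 0 < ρ)
    (hf0 : f 0 ^ 2 = a ^ 2 - b ^ 2) (hf1 : f 1 = 0) :
    polarCurve f ρ (ellipse a b) = (polarCircle f ρ a b : Set Plane) := by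
  ext q
  constructor
  · rintro ⟨L, hL, hq, rfl⟩
    exact (isTangentLine_ellipse_polarLine_iff ha hb hf0 hf1 hq).1 hL
  · intro h
    have hq : q ≠ f := by
      rintro rfl
      exact focus_notMem_polarCircle ha hb hρ hf0 hf1 h
    exact ⟨_, (isTangentLine_ellipse_polarLine_iff ha hb hf0 hf1 hq).2 h, hq, rfl⟩

/-- The polar equation of an ellipse with respect to a focus. -/
theorem exists_polar_angle (ha : 0 < a) (hb : 0 < b) (hρ : 0 < ρ)
    (hf0 : f 0 ^ 2 = a ^ 2 - b ^ 2) (hf1 : f 1 = 0) {p : Plane} (hp : p ∈ ellipse a b) :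
    ∃ α d : ℝ, 0 < d ∧ p 0 - f 0 = d * Real.cos α ∧ p 1 = d * Real.sin α ∧
      d * (ρ ^ 2 * a / b ^ 2 + f 0 * ρ ^ 2 / b ^ 2 * Real.cos α) = ρ ^ 2 := by
  have hpf : p ≠ f := by
    rintro rfl
    exact focus_notMem_ellipse ha hb hf0 hf1 hp
  have hd := normSq_sub_pos hpf
  rw [hf1, sub_zero] at hd
  rw [ellipse_eq_conic, mem_conic ha hb, sub_zero] at hp
  let z : ℂ := ⟨p 0 - f 0, p 1⟩
  have hz : ‖z‖ ^ 2 = (p 0 - f 0) ^ 2 + p 1 ^ 2 := by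
    rw [Complex.sq_norm, Complex.normSq_apply]; ring
  have hz0 : 0 < ‖z‖ := by
    rw [← hz] at hd
    exact lt_of_le_of_ne (norm_nonneg _) fun h => by rw [← h] at hd; simp at hd
  have hcos : p 0 - f 0 = ‖z‖ * Real.cos z.arg := (Complex.norm_mul_cos_arg z).symm
  have hsin : p 1 = ‖z‖ * Real.sin z.arg := (Complex.norm_mul_sin_arg z).symm
  refine ⟨z.arg, ‖z‖, hz0, hcos, hsin, ?_⟩
  have h1 : (b ^ 2 - f 0 * (p 0 - f 0)) ^ 2 = (a * ‖z‖) ^ 2 := by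
    rw [mul_pow, hz]
    linear_combination -hp + (p 0 ^ 2 + f 0 ^ 2 - 2 * f 0 * p 0 + b ^ 2) * hf0
  -- The focal equation without squares; the other sign is impossible since $|f_0(p_0-f_0)|\le
  -- a\|z\|$.
  have h2 : b ^ 2 - f 0 * (p 0 - f 0) = a * ‖z‖ := by
    refine (sq_eq_sq_iff_eq_or_eq_neg.1 h1).resolve_right fun h => ?_
    have h3 : |f 0 * (p 0 - f 0)| ≤ a * ‖z‖ := by
      apply abs_le_of_sq_le_sq _ (by positivity)
      rw [mul_pow, mul_pow, hz, hf0]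
      have := sq_nonneg (b * (p 0 - f 0))
      have := sq_nonneg (a * p 1)
      nlinarith
    have h4 := (abs_le.1 h3).2
    have : 0 < b ^ 2 := by positivity
    linarith
  have h3 : ‖z‖ * (a + f 0 * Real.cos z.arg) = b ^ 2 := by
    linear_combination -h2 - f 0 * hcos
  field_simp
  linear_combination h3

end Polarity

/-! ### The reflection law for tangents to a confocal ellipse -/

section Reflection

theorem reflection_orthogonal_singleton_apply {n : Plane} (v : Plane) :
    (ℝ ∙ n)ᗮ.reflection v = v - (2 * (inner ℝ n v / ‖n‖ ^ 2)) • n := by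
  rw [Submodule.reflection_orthogonal_apply, Submodule.reflection_singleton_apply]
  simp [two_smul, two_mul, add_smul]

theorem unitVec_apply (p q : Plane) (i : Fin 2) : unitVec p q i = ‖q - p‖⁻¹ * (q i - p i) := by
  simp [unitVec]

theorem unitVec_normSq {p q : Plane} (h : p ≠ q) : unitVec p q 0 ^ 2 + unitVec p q 1 ^ 2 = 1 := by
  have h1 : ‖q - p‖ ≠ 0 := norm_ne_zero_iff.2 (sub_ne_zero.2 h.symm)
  have h2 := normSq_eq (q - p)
  simp only [PiLp.sub_apply] at h2
  rw [unitVec_apply, unitVec_apply, mul_pow, mul_pow, ← mul_add, ← h2, ← mul_pow,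
    inv_mul_cancel₀ h1, one_pow]

/-- The reflection law in coordinates: two unit vectors `u`, `v` along lines through `(x, y)` that
are tangent to the confocal ellipse, with `u` pointing outwards and `v` inwards. -/
theorem reflect_of_tangent {a b a' b' n₀ n₁ u₀ u₁ v₀ v₁ : ℝ} (hb : 0 < b) (hab : b < a)
    (ha' : 0 < a') (hb' : 0 < b') (hnested : a' < a) (hconfocal : a' ^ 2 - b' ^ 2 = a ^ 2 - b ^ 2)
    (hn : a ^ 2 * n₀ ^ 2 + b ^ 2 * n₁ ^ 2 = 1) (hu : u₀ ^ 2 + u₁ ^ 2 = 1) (hv : v₀ ^ 2 + v₁ ^ 2 = 1)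
    (hcu : (b ^ 2 * n₁ * u₀ - a ^ 2 * n₀ * u₁) ^ 2 = a' ^ 2 * u₁ ^ 2 + b' ^ 2 * u₀ ^ 2)
    (hcv : (b ^ 2 * n₁ * v₀ - a ^ 2 * n₀ * v₁) ^ 2 = a' ^ 2 * v₁ ^ 2 + b' ^ 2 * v₀ ^ 2)
    (hun : 0 < n₀ * u₀ + n₁ * u₁) (hvn : n₀ * v₀ + n₁ * v₁ < 0) :
    (u₀ - 2 * ((n₀ * u₀ + n₁ * u₁) / (n₀ ^ 2 + n₁ ^ 2)) * n₀ = v₀ ∧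
      u₁ - 2 * ((n₀ * u₀ + n₁ * u₁) / (n₀ ^ 2 + n₁ ^ 2)) * n₁ = v₁) ↔
      ¬ (v₀ = -u₀ ∧ v₁ = -u₁) := by
  have hN : 0 < n₀ ^ 2 + n₁ ^ 2 := by
    by_contra hcon
    have h0 : n₀ ^ 2 = 0 := by nlinarith [sq_nonneg n₀, sq_nonneg n₁]
    have h1 : n₁ ^ 2 = 0 := by nlinarith [sq_nonneg n₀, sq_nonneg n₁]
    rw [h0, h1] at hn
    norm_num at hn
  set N := n₀ ^ 2 + n₁ ^ 2 with hNdef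
  set K := a ^ 2 - a' ^ 2 with hK
  set M := b' ^ 2 + (a ^ 2 - b ^ 2) * b ^ 2 * n₁ ^ 2 with hM
  have hK0 : 0 < K := by
    have : a' ^ 2 < a ^ 2 := by gcongr
    linarith
  have hM0 : 0 < M := by
    have h1 : b ^ 2 < a ^ 2 := by gcongr
    have h2 : 0 ≤ (a ^ 2 - b ^ 2) * b ^ 2 * n₁ ^ 2 :=
      mul_nonneg (mul_nonneg (by linarith) (sq_nonneg _)) (sq_nonneg _)
    have : 0 < b' ^ 2 := by positivity
    linarith
  -- For each unit tangent direction to the caustic, the squared normal and tangential components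
  -- are in the ratio $K:M$, which depends only on the point. This is where confocality enters; `u`
  -- and `v` can then differ only in signs.
  have key : ∀ {w₀ w₁ : ℝ}, w₀ ^ 2 + w₁ ^ 2 = 1 →
      (b ^ 2 * n₁ * w₀ - a ^ 2 * n₀ * w₁) ^ 2 = a' ^ 2 * w₁ ^ 2 + b' ^ 2 * w₀ ^ 2 →
      (n₀ * w₀ + n₁ * w₁) ^ 2 * (K + M) = K * N ∧
        (n₀ * w₁ - n₁ * w₀) ^ 2 * (K + M) = M * N := by
    intro w₀ w₁ hw hcw
    have e1 : (n₀ * w₀ + n₁ * w₁) ^ 2 + (n₀ * w₁ - n₁ * w₀) ^ 2 = N := by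
      linear_combination N * hw
    have e2 : N * (K * (n₀ * w₁ - n₁ * w₀) ^ 2 - M * (n₀ * w₀ + n₁ * w₁) ^ 2) = 0 := by
      have hA : a' ^ 2 = b' ^ 2 + a ^ 2 - b ^ 2 := by linarith
      rw [hA] at hcw
      rw [hK, hM, hA, hNdef]
      linear_combination (n₀ ^ 2 + n₁ ^ 2) ^ 2 * hcw -
        ((a ^ 2 - b ^ 2) * n₁ ^ 2 * (n₀ * w₀ + n₁ * w₁) ^ 2 +
          (a ^ 2 * n₀ ^ 2 + b ^ 2 * n₁ ^ 2) * (n₀ * w₁ - n₁ * w₀) ^ 2 +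
          2 * (a ^ 2 - b ^ 2) * n₀ * n₁ * (n₀ * w₀ + n₁ * w₁) * (n₀ * w₁ - n₁ * w₀)) * hn
    have e3 := (mul_eq_zero.1 e2).resolve_left hN.ne'
    constructor
    · linear_combination K * e1 - e3
    · linear_combination M * e1 + e3
  obtain ⟨ku, ku'⟩ := key hu hcu
  obtain ⟨kv, kv'⟩ := key hv hcv
  have hKM : K + M ≠ 0 := by positivity
  have hnorm : n₀ * v₀ + n₁ * v₁ = -(n₀ * u₀ + n₁ * u₁) := by
    refine (sq_eq_sq_iff_eq_or_eq_neg.1 (mul_right_cancel₀ hKM (kv.trans ku.symm))).resolve_left ?_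
    intro h
    linarith
  have htang := sq_eq_sq_iff_eq_or_eq_neg.1 (mul_right_cancel₀ hKM (kv'.trans ku'.symm))
  have htang0 : n₀ * u₁ - n₁ * u₀ ≠ 0 := by
    intro h
    rw [h] at ku'
    have : 0 < M * N := by positivity
    simp at ku'
    rcases ku' with h | h <;> linarith
  constructor
  · rintro ⟨h0, h1⟩ ⟨h2, h3⟩
    apply htang0
    rw [h2] at h0
    rw [h3] at h1
    linear_combination n₀ / 2 * h1 - n₁ / 2 * h0
  · intro hne
    have ht : n₀ * v₁ - n₁ * v₀ = n₀ * u₁ - n₁ * u₀ := by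
      refine htang.resolve_right fun h => hne ⟨?_, ?_⟩
      · apply mul_left_cancel₀ hN.ne'
        linear_combination n₀ * hnorm - n₁ * h
      · apply mul_left_cancel₀ hN.ne'
        linear_combination n₁ * hnorm + n₀ * h
    constructor
    · apply mul_left_cancel₀ hN.ne'
      field_simp
      linear_combination -n₀ * hnorm + n₁ * ht
    · apply mul_left_cancel₀ hN.ne'
      field_simp
      linear_combination -n₁ * hnorm - n₀ * ht

end Reflection

/-! ### Polar duality between billiard periodics and bicentric polygons -/

section Duality

variable {f : Plane} {ρ a b a' b' : ℝ}

/-- A unit vector along a polar line whose pole lies on the polar circle of an ellipse satisfies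
the tangency condition for that ellipse. -/
theorem tangent_condition (ha' : 0 < a') (hb' : 0 < b') (hρ : 0 < ρ)
    (hf0 : f 0 ^ 2 = a' ^ 2 - b' ^ 2) (hf1 : f 1 = 0)
    {q X P : Plane} (hq : q ≠ f) (hqC : q ∈ (polarCircle f ρ a' b' : Set Plane))
    (hX : X ∈ polarLine f ρ q) (hP : P ∈ polarLine f ρ q) {w : Plane}
    (hw : w 0 ^ 2 + w 1 ^ 2 = 1) {s : ℝ} (hw0 : w 0 = s * (P 0 - X 0))
    (hw1 : w 1 = s * (P 1 - X 1)) :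
    (P 1 * w 0 - P 0 * w 1) ^ 2 = a' ^ 2 * w 1 ^ 2 + b' ^ 2 * w 0 ^ 2 := by
  rw [mem_polarLine hq, hf1, sub_zero, sub_zero] at hX hP
  rw [mem_polarCircle ha' hb' hf0] at hqC
  set v := q 0 - f 0
  have hperp : v * w 0 + q 1 * w 1 = 0 := by
    rw [hw0, hw1]; linear_combination s * (hP - hX)
  -- The vector $q-f$ is `t` times the normal $(-w_1,w_0)$; `g` below is the signed distance from
  -- `f` to the line, so $tg=\rho^2$.
  set t := q 1 * w 0 - v * w 1 with ht
  have hv0 : v = -t * w 1 := by rw [ht]; linear_combination w 0 * hperp - v * hw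
  have hv1 : q 1 = t * w 0 := by rw [ht]; linear_combination w 1 * hperp - q 1 * hw
  set g := P 1 * w 0 - (P 0 - f 0) * w 1 with hg
  have htg : t * g = ρ ^ 2 := by
    rw [hg]; rw [hv0, hv1] at hP; linear_combination hP
  have ht0 : t ^ 2 ≠ 0 := by
    intro h
    rw [pow_eq_zero_iff two_ne_zero] at h
    rw [h, zero_mul] at htg
    exact absurd htg.symm (by positivity)
  have hgb : b' ^ 2 = g ^ 2 - 2 * f 0 * g * w 1 := by
    apply mul_left_cancel₀ ht0
    rw [hv0, hv1] at hqC
    have hρ4 : ρ ^ 4 = (t * g) ^ 2 := by rw [htg]; ring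
    rw [hρ4, ← htg] at hqC
    linear_combination hqC - b' ^ 2 * t ^ 2 * hw
  have hPg : P 1 * w 0 - P 0 * w 1 = g - f 0 * w 1 := by rw [hg]; ring
  rw [hPg]
  linear_combination -hgb + w 1 ^ 2 * hf0 - b' ^ 2 * hw

/-- Strict convexity: the expression is half the squared length of $P-X$ in the norm of the ellipse.
It makes arrival at `P` outward and departure inward. -/
theorem normal_dot_sub_pos (ha : 0 < a) (hb : 0 < b) {P X : Plane} (hP : P ∈ ellipse a b)
    (hX : X ∈ ellipse a b) (hne : P ≠ X) :
    0 < P 0 / a ^ 2 * (P 0 - X 0) + P 1 / b ^ 2 * (P 1 - X 1) := by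
  have h := normSq_sub_pos hne
  rw [ellipse, Set.mem_ofPred_eq] at hP hX
  have e : P 0 / a ^ 2 * (P 0 - X 0) + P 1 / b ^ 2 * (P 1 - X 1) =
      ((P 0 - X 0) ^ 2 / a ^ 2 + (P 1 - X 1) ^ 2 / b ^ 2) / 2 := by
    linear_combination (hP - hX) / 2
  rw [e]
  rcases eq_or_ne (P 0 - X 0) 0 with h0 | h0
  · have : 0 < (P 1 - X 1) ^ 2 := by simpa [h0] using h
    positivity
  · positivity

/-- Two consecutive sides that are tangent to the confocal ellipse obey the reflection law iff the
motion does not double back. -/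
theorem reflects_iff_ne (hb : 0 < b) (hab : b < a) (ha' : 0 < a') (hb' : 0 < b')
    (hnested : a' < a) (hconfocal : a' ^ 2 - b' ^ 2 = a ^ 2 - b ^ 2) (hρ : 0 < ρ)
    (hf0 : f 0 ^ 2 = a ^ 2 - b ^ 2) (hf1 : f 1 = 0) {X P Y q q' : Plane}
    (hX : X ∈ ellipse a b) (hP : P ∈ ellipse a b) (hY : Y ∈ ellipse a b)
    (hXP : X ≠ P) (hPY : P ≠ Y) (hq : q ≠ f) (hq' : q' ≠ f)
    (hqC : q ∈ (polarCircle f ρ a' b' : Set Plane)) (hqC' : q' ∈ (polarCircle f ρ a' b' : Set Plane))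
    (hXq : X ∈ polarLine f ρ q) (hPq : P ∈ polarLine f ρ q)
    (hPq' : P ∈ polarLine f ρ q') (hYq' : Y ∈ polarLine f ρ q') :
    (ℝ ∙ ellipseNormal a b P)ᗮ.reflection (unitVec X P) = unitVec P Y ↔ X ≠ Y := by
  have ha : 0 < a := hb.trans hab
  have hf0' : f 0 ^ 2 = a' ^ 2 - b' ^ 2 := by rw [hf0, hconfocal]
  have hXPn : 0 < ‖P - X‖ := norm_pos_iff.2 (sub_ne_zero.2 hXP.symm)
  have hPYn : 0 < ‖Y - P‖ := norm_pos_iff.2 (sub_ne_zero.2 hPY.symm)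
  have hu := unitVec_normSq hXP
  have hv := unitVec_normSq hPY
  have hcu := tangent_condition ha' hb' hρ hf0' hf1 hq hqC hXq hPq hu
    (unitVec_apply X P 0) (unitVec_apply X P 1)
  have hcv := tangent_condition ha' hb' hρ hf0' hf1 hq' hqC' hYq' hPq' hv
    (s := -‖Y - P‖⁻¹) (by rw [unitVec_apply]; ring) (by rw [unitVec_apply]; ring)
  have hn : a ^ 2 * (P 0 / a ^ 2) ^ 2 + b ^ 2 * (P 1 / b ^ 2) ^ 2 = 1 := by
    have h := hP
    rw [ellipse, Set.mem_ofPred_eq] at h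
    rw [← h]
    field_simp
  have hP0 : P 0 = a ^ 2 * (P 0 / a ^ 2) := by field_simp
  have hP1 : P 1 = b ^ 2 * (P 1 / b ^ 2) := by field_simp
  have hun : 0 < P 0 / a ^ 2 * unitVec X P 0 + P 1 / b ^ 2 * unitVec X P 1 := by
    rw [unitVec_apply, unitVec_apply]
    have := mul_pos (inv_pos.2 hXPn) (normal_dot_sub_pos ha hb hP hX hXP.symm)
    linarith
  have hvn : P 0 / a ^ 2 * unitVec P Y 0 + P 1 / b ^ 2 * unitVec P Y 1 < 0 := by
    rw [unitVec_apply, unitVec_apply]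
    have := mul_pos (inv_pos.2 hPYn) (normal_dot_sub_pos ha hb hP hY hPY)
    linarith
  rw [hP0, hP1] at hcu hcv
  have key := reflect_of_tangent hb hab ha' hb' hnested hconfocal hn hu hv hcu hcv hun hvn
  have hrefl : (ℝ ∙ ellipseNormal a b P)ᗮ.reflection (unitVec X P) = unitVec P Y ↔
      ¬ (unitVec P Y 0 = -unitVec X P 0 ∧ unitVec P Y 1 = -unitVec X P 1) := by
    rw [← key, reflection_orthogonal_singleton_apply, inner_eq, normSq_eq]
    constructor
    · intro h
      have h0 := congrArg (fun p : Plane => p 0) h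
      have h1 := congrArg (fun p : Plane => p 1) h
      exact ⟨by simpa [ellipseNormal] using h0, by simpa [ellipseNormal] using h1⟩
    · rintro ⟨h0, h1⟩
      apply plane_ext
      · simpa [ellipseNormal] using h0
      · simpa [ellipseNormal] using h1
  rw [hrefl, ne_eq, not_iff_not]
  constructor
  · rintro ⟨h0, h1⟩
    have hYl : Y = AffineMap.lineMap P X (‖Y - P‖ / ‖P - X‖) := by
      rw [unitVec_apply, unitVec_apply] at h0 h1
      rw [AffineMap.lineMap_apply]
      apply plane_ext
      · simp
        field_simp at h0 ⊢
        linear_combination h0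
      · simp
        field_simp at h1 ⊢
        linear_combination h1
    have hYq : Y ∈ polarLine f ρ q := by
      rw [hYl]
      exact AffineMap.lineMap_mem _ hPq hXq
    rw [ellipse_eq_conic] at hX hP hY
    exact eq_of_mem_conic_of_mem_polarLine ha hb hq hX hP hY hXq hPq hYq hXP hPY
  · rintro rfl
    rw [unitVec_apply, unitVec_apply, unitVec_apply, unitVec_apply, norm_sub_rev]
    constructor <;> ring

theorem isPole_of_mem {A B : Plane} (hq : q ≠ f) (hAB : A ≠ B)
    (hA : A ∈ polarLine f ρ q) (hB : B ∈ polarLine f ρ q) : IsPole f ρ q line[ℝ, A, B] :=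
  ⟨hq, line_eq_polarLine hq hAB hA hB⟩

theorem left_mem_sideline {N : ℕ} (P : Polygon N) (j : ZMod N) : P j ∈ sideline P j :=
  left_mem_affineSpan_pair ℝ _ _

theorem right_mem_sideline {N : ℕ} (P : Polygon N) (j : ZMod N) : P (j + 1) ∈ sideline P j :=
  right_mem_affineSpan_pair ℝ _ _

/-- The polar polygon of a billiard periodic is bicentric. -/
theorem exists_bicentric_of_periodic (hb : 0 < b) (hab : b < a) (ha' : 0 < a') (hb' : 0 < b')
    (hnested : a' < a) (hconfocal : a' ^ 2 - b' ^ 2 = a ^ 2 - b ^ 2) (hρ : 0 < ρ)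
    (hf0 : f 0 ^ 2 = a ^ 2 - b ^ 2) (hf1 : f 1 = 0) {N : ℕ} {P : Polygon N}
    (hP : P ∈ periodics a b a' b' N) :
    ∃ Q ∈ bicentrics (polarCircle f ρ a' b') (polarCircle f ρ a b) N,
      IsPolarPolygon f ρ P Q ∧ (∀ j, Q (j - 1) ≠ Q j) ∧
        ∀ j, pedal f Q j = invert f ρ P (j + 1) := by
  have ha : 0 < a := hb.trans hab
  have hf0' : f 0 ^ 2 = a' ^ 2 - b' ^ 2 := by rw [hf0, hconfocal]
  obtain ⟨⟨hmem, hne, hrefl⟩, htan⟩ := hP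
  have hPf : ∀ j, P j ≠ f := fun j h => focus_notMem_ellipse ha hb hf0 hf1 (h ▸ hmem j)
  have hpole : ∀ j, ∃ q, IsPole f ρ q (sideline P j) := fun j =>
    exists_isPole hρ (hne j) (focus_notMem_of_isTangentLine_ellipse ha' hb' hf0' hf1 (htan j))
  choose Q hQ using hpole
  have hQf : ∀ j, Q j ≠ f := fun j => (hQ j).1
  have hl : ∀ j, P j ∈ polarLine f ρ (Q j) := fun j => (hQ j).2 ▸ left_mem_sideline P j
  have hr : ∀ j, P (j + 1) ∈ polarLine f ρ (Q j) := fun j => (hQ j).2 ▸ right_mem_sideline P j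
  have hl' : ∀ j, P (j - 1) ∈ polarLine f ρ (Q (j - 1)) := fun j => hl (j - 1)
  have hr' : ∀ j, P j ∈ polarLine f ρ (Q (j - 1)) := fun j => by
    simpa using hr (j - 1)
  have hne' : ∀ j, P (j - 1) ≠ P j := fun j => by simpa using hne (j - 1)
  have hQC : ∀ j, Q j ∈ (polarCircle f ρ a' b' : Set Plane) := fun j =>
    (isTangentLine_ellipse_polarLine_iff ha' hb' hf0' hf1 (hQf j)).1 ((hQ j).2 ▸ htan j)
  have hback : ∀ j, P (j - 1) ≠ P (j + 1) := fun j =>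
    (reflects_iff_ne hb hab ha' hb' hnested hconfocal hρ hf0 hf1 (hmem _) (hmem _) (hmem _)
      (hne' j) (hne j) (hQf (j - 1)) (hQf j) (hQC _) (hQC _) (hl' j) (hr' j) (hl j) (hr j)).1
      (hrefl j)
  -- Three consecutive vertices on one line would force $P_{j-1}=P_{j+1}$, as a line meets the
  -- ellipse at most twice.
  have hcol : ∀ j, P (j + 1) ∉ polarLine f ρ (Q (j - 1)) := by
    intro j h
    have hmem' : ∀ j, P j ∈ conic 0 a b := fun j => ellipse_eq_conic a b ▸ hmem j
    exact hback j (eq_of_mem_conic_of_mem_polarLine ha hb (hQf (j - 1)) (hmem' _) (hmem' _)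
      (hmem' _) (hl' j) (hr' j) h (hne' j) (hne j))
  have hQ1 : ∀ j, Q (j - 1) ≠ Q j := fun j h => hcol j (h ▸ hr j)
  have hQ2 : ∀ j, Q j ≠ Q (j + 1) := fun j => by simpa using hQ1 (j + 1)
  have hside : ∀ j, sideline Q j = polarLine f ρ (P (j + 1)) := fun j =>
    line_eq_polarLine (hPf _) (hQ2 j) ((mem_polarLine_comm (hQf _) (hPf _)).1 (hr j))
      ((mem_polarLine_comm (hQf _) (hPf _)).1 (hl (j + 1)))
  refine ⟨Q, ⟨hQC, fun j h => hcol j ?_, fun j => ?_⟩, hQ, hQ1, fun j =>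
    pedal_eq_inversion (hside j)⟩
  · rw [h]
    exact hl (j + 1)
  · rw [hside]
    exact (isTangentLine_polarCircle_polarLine_iff ha hb hρ hf0 hf1 (hPf _)).2 (hmem _)

/-- Every bicentric polygon is the polar polygon of a billiard periodic. -/
theorem exists_periodic_of_bicentric (hb : 0 < b) (hab : b < a) (ha' : 0 < a') (hb' : 0 < b')
    (hnested : a' < a) (hconfocal : a' ^ 2 - b' ^ 2 = a ^ 2 - b ^ 2) (hρ : 0 < ρ)
    (hf0 : f 0 ^ 2 = a ^ 2 - b ^ 2) (hf1 : f 1 = 0) {N : ℕ} {Q : Polygon N}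
    (hQ : Q ∈ bicentrics (polarCircle f ρ a' b') (polarCircle f ρ a b) N) :
    ∃ P ∈ periodics a b a' b' N,
      IsPolarPolygon f ρ P Q ∧ ∀ j, pedal f Q j = invert f ρ P (j + 1) := by
  have ha : 0 < a := hb.trans hab
  have hf0' : f 0 ^ 2 = a' ^ 2 - b' ^ 2 := by rw [hf0, hconfocal]
  obtain ⟨hQC, hback, htan⟩ := hQ
  have hQC' : ∀ j, Q j ∈ (polarCircle f ρ a' b' : Set Plane) := hQC
  have hQf : ∀ j, Q j ≠ f := fun j h =>
    focus_notMem_polarCircle ha' hb' hρ hf0' hf1 (h ▸ hQC' j)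
  have hne : ∀ j, Q j ≠ Q (j + 1) := fun j => ne_of_finrank_line (htan j).1
  have hpole : ∀ j, ∃ p, IsPole f ρ p (sideline Q j) := fun j =>
    exists_isPole hρ (hne j) (focus_notMem_of_isTangentLine_polarCircle ha hb hρ hf0 hf1 (htan j))
  choose p hp using hpole
  -- The shift by one is forced: $Q_jQ_{j+1}$ is dual to the vertex shared by sides $j$ and $j+1$ of
  -- `P`.
  obtain ⟨P, hPp⟩ : ∃ P : Polygon N, ∀ j, P (j + 1) = p j := ⟨fun j => p (j - 1), by simp⟩
  have hP : ∀ j, IsPole f ρ (P (j + 1)) (sideline Q j) := fun j => by rw [hPp]; exact hp j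
  have hP' : ∀ j, IsPole f ρ (P j) (sideline Q (j - 1)) := fun j => by
    simpa using hP (j - 1)
  have hPf : ∀ j, P j ≠ f := fun j => (hP' j).1
  have hl : ∀ j, Q j ∈ polarLine f ρ (P (j + 1)) := fun j => (hP j).2 ▸ left_mem_sideline Q j
  have hr : ∀ j, Q j ∈ polarLine f ρ (P j) := fun j => by
    have := (hP' j).2 ▸ right_mem_sideline Q (j - 1)
    simpa using this
  have hl' : ∀ j, Q (j - 1) ∈ polarLine f ρ (P j) := fun j => by simpa using hl (j - 1)
  have hne' : ∀ j, Q (j - 1) ≠ Q j := fun j => by simpa using hne (j - 1)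
  have hmem : ∀ j, P j ∈ ellipse a b := fun j =>
    (isTangentLine_polarCircle_polarLine_iff ha hb hρ hf0 hf1 (hPf j)).1
      ((hP' j).2 ▸ htan (j - 1))
  have hcol : ∀ j, Q (j + 1) ∉ polarLine f ρ (P j) := by
    intro j h
    have hr0 : 0 < ρ ^ 2 * a' / b' ^ 2 := by positivity
    have hc : ∀ j, Q j ∈ conic (f 0 + f 0 * ρ ^ 2 / b' ^ 2) (ρ ^ 2 * a' / b' ^ 2)
      (ρ ^ 2 * a' / b' ^ 2) := fun j => coe_polarCircle ha' hb' hρ ▸ hQC' j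
    exact hback j (eq_of_mem_conic_of_mem_polarLine hr0 hr0 (hPf j) (hc _) (hc _) (hc _)
      (hl' j) (hr j) h (hne' j) (hne j))
  have hP1 : ∀ j, P j ≠ P (j + 1) := fun j h => hcol j (by rw [h]; exact hr (j + 1))
  have hP1' : ∀ j, P (j - 1) ≠ P j := fun j => by simpa using hP1 (j - 1)
  have hP2 : ∀ j, P (j - 1) ≠ P (j + 1) := by
    intro j h
    apply hcol (j - 1)
    rw [sub_add_cancel, h]
    exact hl j
  have hll : ∀ j, P j ∈ polarLine f ρ (Q j) := fun j =>
    (mem_polarLine_comm (hPf _) (hQf _)).1 (hr j)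
  have hrr : ∀ j, P (j + 1) ∈ polarLine f ρ (Q j) := fun j =>
    (mem_polarLine_comm (hPf _) (hQf _)).1 (hl j)
  have hrr' : ∀ j, P j ∈ polarLine f ρ (Q (j - 1)) := fun j =>
    (mem_polarLine_comm (hPf _) (hQf _)).1 (hl' j)
  have hpolar : IsPolarPolygon f ρ P Q := fun j => isPole_of_mem (hQf j) (hP1 j) (hll j) (hrr j)
  refine ⟨P, ⟨⟨hmem, hP1, fun j => ?_⟩, fun j => ?_⟩, hpolar, fun j =>
    pedal_eq_inversion (hP j).2⟩
  · exact (reflects_iff_ne hb hab ha' hb' hnested hconfocal hρ hf0 hf1 (hmem _) (hmem _) (hmem _)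
      (hP1' j) (hP1 j) (hQf (j - 1)) (hQf j) (hQC' _) (hQC' _) (hll (j - 1)) (hrr' j) (hll j)
      (hrr j)).2 (hP2 j)
  · rw [(hpolar j).2]
    exact (isTangentLine_ellipse_polarLine_iff ha' hb' hf0' hf1 (hQf j)).2 (hQC' j)

end Duality

/-! ### Relative position of the polar circles, and their limiting point -/

section Circles

variable {f : Plane} {ρ a b a' b' : ℝ}

theorem abs_focus_lt (ha : 0 < a) (hb : 0 < b) (hf0 : f 0 ^ 2 = a ^ 2 - b ^ 2) : |f 0| < a := by
  apply abs_lt_of_sq_lt_sq _ ha.le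
  have : 0 < b ^ 2 := by positivity
  linarith

theorem lt_minor (hb : 0 < b) (ha' : 0 < a') (hnested : a' < a)
    (hconfocal : a' ^ 2 - b' ^ 2 = a ^ 2 - b ^ 2) : b' < b := by
  apply lt_of_pow_lt_pow_left₀ 2 hb.le
  have : a' ^ 2 < a ^ 2 := by gcongr
  linarith

/-- The polar circle of the inner ellipse strictly encloses that of the outer one. -/
theorem polarCircle_nested (ha : 0 < a) (hb : 0 < b) (ha' : 0 < a') (hb' : 0 < b')
    (hnested : a' < a) (hconfocal : a' ^ 2 - b' ^ 2 = a ^ 2 - b ^ 2) (hρ : 0 < ρ)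
    (hf0 : f 0 ^ 2 = a ^ 2 - b ^ 2) :
    ρ ^ 2 * a / b ^ 2 + |f 0 * ρ ^ 2 / b' ^ 2 - f 0 * ρ ^ 2 / b ^ 2| < ρ ^ 2 * a' / b' ^ 2 := by
  have hbb := lt_minor hb ha' hnested hconfocal
  have hc : |f 0| ^ 2 = a ^ 2 - b ^ 2 := by rw [sq_abs, hf0]
  have hc0 := abs_nonneg (f 0)
  have hinv : 0 < 1 / b' ^ 2 - 1 / b ^ 2 := sub_pos.2 (by gcongr)
  rw [show f 0 * ρ ^ 2 / b' ^ 2 - f 0 * ρ ^ 2 / b ^ 2 = ρ ^ 2 * (f 0 * (1 / b' ^ 2 - 1 / b ^ 2)) by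
    ring, abs_mul, abs_mul, abs_of_pos hinv, abs_of_nonneg (sq_nonneg ρ)]
  set c := |f 0|
  -- From $b^2=(a-c)(a+c)$; the nesting reduces to $1/(a+c)<1/(a'+c)$, a comparison of inverses of
  -- the far vertices.
  have h1 : (a - c) / b ^ 2 = 1 / (a + c) := by
    field_simp
    linear_combination -hc
  have h2 : (a' - c) / b' ^ 2 = 1 / (a' + c) := by
    field_simp
    linear_combination hconfocal - hc
  have h3 : 1 / (a + c) < 1 / (a' + c) := by gcongr
  rw [← h1, ← h2] at h3
  have h4 := mul_lt_mul_of_pos_left h3 (show 0 < ρ ^ 2 by positivity)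
  have e1 : ρ ^ 2 * a / b ^ 2 = ρ ^ 2 * ((a - c) / b ^ 2) + ρ ^ 2 * c * (1 / b ^ 2) := by ring
  have e2 : ρ ^ 2 * a' / b' ^ 2 = ρ ^ 2 * ((a' - c) / b' ^ 2) + ρ ^ 2 * c * (1 / b' ^ 2) := by ring
  rw [e1, e2]
  linarith

theorem dist_horizontal (x y : ℝ) : dist (!₂[x, 0] : Plane) !₂[y, 0] = |x - y| := by
  rw [EuclideanSpace.dist_eq, Fin.sum_univ_two]
  simp [Real.dist_eq, Real.sqrt_sq_eq_abs]

theorem eq_horizontal (hf1 : f 1 = 0) : f = !₂[f 0, 0] :=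
  plane_ext (by simp) (by simpa using hf1)

theorem dist_focus_center_lt (ha : 0 < a) (hb : 0 < b) (hρ : 0 < ρ)
    (hf0 : f 0 ^ 2 = a ^ 2 - b ^ 2) (hf1 : f 1 = 0) :
    dist f (polarCircle f ρ a b).center < (polarCircle f ρ a b).radius := by
  have h := abs_focus_lt ha hb hf0
  have e : dist f (polarCircle f ρ a b).center = ρ ^ 2 * |f 0| / b ^ 2 := by
    calc dist f (polarCircle f ρ a b).center
        = dist (!₂[f 0, 0] : Plane) !₂[f 0 + f 0 * ρ ^ 2 / b ^ 2, 0] := by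
          rw [← eq_horizontal hf1]; rfl
      _ = |-(ρ ^ 2 * f 0 / b ^ 2)| := by rw [dist_horizontal]; congr 1; ring
      _ = _ := by
        rw [abs_neg, abs_div, abs_mul, abs_of_nonneg (sq_nonneg ρ), abs_of_nonneg (sq_nonneg b)]
  rw [e]
  change _ < ρ ^ 2 * a / b ^ 2
  gcongr

/-- The common focus is a limiting point of the two polar circles. -/
theorem isLimitingPoint_polarCircle (ha : 0 < a) (hb : 0 < b) (ha' : 0 < a') (hb' : 0 < b')
    (hbb : b' < b) (hconfocal : a' ^ 2 - b' ^ 2 = a ^ 2 - b ^ 2) (hρ : 0 < ρ)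
    (hf0 : f 0 ^ 2 = a ^ 2 - b ^ 2) (hf1 : f 1 = 0) :
    IsLimitingPoint (polarCircle f ρ a' b') (polarCircle f ρ a b) f := by
  have hf0' : f 0 ^ 2 = a' ^ 2 - b' ^ 2 := by rw [hf0, hconfocal]
  constructor
  · have hD : b ^ 2 - b' ^ 2 ≠ 0 := by
      have : b' ^ 2 < b ^ 2 := by gcongr
      linarith
    have : f = AffineMap.lineMap (polarCircle f ρ a' b').center (polarCircle f ρ a b).center
        (b ^ 2 / (b ^ 2 - b' ^ 2)) := by
      rw [AffineMap.lineMap_apply]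
      apply plane_ext
      · simp [polarCircle]
        field_simp
        ring
      · simp [polarCircle, hf1]
    have hm := AffineMap.lineMap_mem_affineSpan_pair (k := ℝ) (b ^ 2 / (b ^ 2 - b' ^ 2))
      (polarCircle f ρ a' b').center (polarCircle f ρ a b).center
    rwa [← this] at hm
  · intro k hk
    -- Here $m/w=f_0/\rho^2$ involves neither `a` nor `b`, so both images have the same centre.
    have image : ∀ {a b : ℝ}, 0 < a → 0 < b → f 0 ^ 2 = a ^ 2 - b ^ 2 →
        inversion f k '' (polarCircle f ρ a b : Set Plane) =
          Metric.sphere (!₂[f 0 - f 0 / ρ ^ 2 * k ^ 2, 0] : Plane) (k ^ 2 * a / ρ ^ 2) := by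
      intro a b ha hb hf0
      have h := inversion_image_sphere (f := f) (m := f 0 * ρ ^ 2 / b ^ 2)
        (r := ρ ^ 2 * a / b ^ 2) (w := ρ ^ 4 / b ^ 2) hk (by positivity)
        (by field_simp; linear_combination hf0) (by positivity) hf1
      have e1 : f 0 * ρ ^ 2 / b ^ 2 / (ρ ^ 4 / b ^ 2) = f 0 / ρ ^ 2 := by field_simp
      have e2 : k ^ 2 * (ρ ^ 2 * a / b ^ 2) / (ρ ^ 4 / b ^ 2) = k ^ 2 * a / ρ ^ 2 := by
        field_simp
      rw [e1, e2] at h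
      exact h
    exact ⟨_, _, _, by positivity, by positivity, image ha' hb' hf0', image ha hb hf0⟩

end Circles

/-! ### Invariance of the perimeter -/

/-- The perimeter of the focus-inversive polygon is the same for all billiard periodics. -/
theorem exists_perimeter_invert_eq {f : Plane} {ρ a b a' b' : ℝ} (hb : 0 < b) (hab : b < a)
    (ha' : 0 < a') (hb' : 0 < b') (hnested : a' < a)
    (hconfocal : a' ^ 2 - b' ^ 2 = a ^ 2 - b ^ 2) (hρ : 0 < ρ)
    (hf0 : f 0 ^ 2 = a ^ 2 - b ^ 2) (hf1 : f 1 = 0) (N : ℕ) [NeZero N] :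
    ∃ L : ℝ, ∀ P ∈ periodics a b a' b' N, perimeter (invert f ρ P) = L := by
  have ha : 0 < a := hb.trans hab
  have hbb := lt_minor hb ha' hnested hconfocal
  have hf0' : f 0 ^ 2 = a' ^ 2 - b' ^ 2 := by rw [hf0, hconfocal]
  have hR := polarCircle_nested ha hb ha' hb' hnested hconfocal hρ hf0
  set r := ρ ^ 2 * a / b ^ 2 with hrdef
  set R := ρ ^ 2 * a' / b' ^ 2 with hRdef
  set m := f 0 * ρ ^ 2 / b ^ 2 with hm
  set δ := f 0 * ρ ^ 2 / b' ^ 2 - m with hδ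
  have hr : 0 < r := by positivity
  -- Ratio of the tangent length to $\mathcal C_{int}$ and the distance to `f`, for points of
  -- $\mathcal C_{ext}$; it comes from comparing the two equations in `mem_polarCircle`.
  set κ := √(1 - b' ^ 2 / b ^ 2) with hκdef
  have hκ0 : 0 < 1 - b' ^ 2 / b ^ 2 := by
    rw [sub_pos, div_lt_one (by positivity)]
    gcongr
  have hκ : 0 < κ := Real.sqrt_pos.2 hκ0
  have hκ2 : κ ^ 2 = 1 - b' ^ 2 / b ^ 2 := Real.sq_sqrt hκ0.le
  obtain ⟨S₀, hS⟩ := exists_sum_cos_eq_of_tangent_polygon hr hR N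
  refine ⟨N * (r / κ * (2 - 2 * r ^ 2 / (R ^ 2 - δ ^ 2))) +
    2 * δ * r ^ 2 / (κ * (R ^ 2 - δ ^ 2)) * (S₀ + S₀), fun P hP => ?_⟩
  obtain ⟨Q, hQ, hpolar, hQne, -⟩ := exists_bicentric_of_periodic hb hab ha' hb' hnested hconfocal
    hρ hf0 hf1 hP
  have hmem := hP.1.mem
  have hne := hP.1.ne
  have hQC : ∀ j, Q j ∈ (polarCircle f ρ a' b' : Set Plane) := hQ.1
  choose α d hd hc hs hpol using fun j => exists_polar_angle (ρ := ρ) ha hb hρ hf0 hf1 (hmem j)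
  -- The polar angle of $P_i$ about `f` is also the contact angle on $\mathcal C_{int}$ of the polar
  -- of $P_i$, now with the origin at the centre of $\mathcal C_{int}$.
  have tangent : ∀ i j, P i ∈ polarLine f ρ (Q j) →
      (Q j 0 - f 0 - m) * Real.cos (α i) + Q j 1 * Real.sin (α i) = r := by
    intro i j h
    rw [mem_polarLine (hpolar j).1, hf1, sub_zero, sub_zero, hc, hs] at h
    apply mul_left_cancel₀ (hd i).ne'
    linear_combination h - hpol i
  have hl : ∀ j, P j ∈ polarLine f ρ (Q j) := fun j => (hpolar j).2 ▸ left_mem_sideline P j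
  have hr' : ∀ j, P (j + 1) ∈ polarLine f ρ (Q j) := fun j =>
    (hpolar j).2 ▸ right_mem_sideline P j
  have hcirc : ∀ j, (Q j 0 - f 0 - m - δ) ^ 2 + Q j 1 ^ 2 = R ^ 2 := by
    intro j
    have h := (mem_sphere_iff (c := (polarCircle f ρ a' b').center) (s := R) (by positivity)).1 (hQC j)
    simp only [polarCircle, Matrix.cons_val_zero, Matrix.cons_val_one, sub_zero] at h
    rw [← h, hδ]
    ring
  have hangle : ∀ j, ¬ (Real.cos (α j) = Real.cos (α (j + 1)) ∧
      Real.sin (α j) = Real.sin (α (j + 1))) := by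
    rintro j ⟨h1, h2⟩
    -- The polar equation determines the distance from the angle, so equal angles would make
    -- consecutive vertices coincide.
    have h3 : d j = d (j + 1) := by
      have e1 := hpol j
      have e2 := hpol (j + 1)
      rw [← h1] at e2
      refine mul_right_cancel₀ (fun h0 => ?_) (e1.trans e2.symm)
      rw [h0, mul_zero] at e1
      exact absurd e1.symm (by positivity)
    apply hne j
    apply plane_ext
    · linarith [hc j, hc (j + 1), congrArg₂ (· * ·) h3 h1]
    · linarith [hs j, hs (j + 1), congrArg₂ (· * ·) h3 h2]
  have hsum : ∑ j, Real.cos (α j) = S₀ := by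
    apply hS α (fun j => Q j 0 - f 0 - m) (fun j => Q j 1) hcirc (fun j => tangent j j (hl j))
      (fun j => tangent j (j - 1) (by simpa using hr' (j - 1))) _ hangle
    rintro j ⟨h1, h2⟩
    exact hQne j (plane_ext (by linarith) h2)
  have hinv : ∀ j, invert f ρ P j 0 - f 0 = (r + m * Real.cos (α j)) * Real.cos (α j) ∧
      invert f ρ P j 1 = (r + m * Real.cos (α j)) * Real.sin (α j) := by
    intro j
    have hdj := (hd j).ne'
    have e1 : (P j 0 - f 0) ^ 2 + (P j 1 - f 1) ^ 2 = d j ^ 2 := by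
      rw [hf1, sub_zero, hc, hs]
      linear_combination d j ^ 2 * Real.sin_sq_add_cos_sq (α j)
    have e2 : r + m * Real.cos (α j) = ρ ^ 2 / d j := by
      rw [eq_div_iff hdj, mul_comm]
      exact hpol j
    simp only [invert, inversion_apply]
    rw [e1, e2, hf1, hc, hs]
    constructor <;> field_simp <;> ring
  have hdist : ∀ j, dist (invert f ρ P j) (invert f ρ P (j + 1)) =
      r / κ * (2 - 2 * r ^ 2 / (R ^ 2 - δ ^ 2)) +
        2 * δ * r ^ 2 / (κ * (R ^ 2 - δ ^ 2)) * (Real.cos (α j) + Real.cos (α (j + 1))) := by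
    intro j
    rw [← dist_feet (m := m) (s := Real.sin (α j)) (s' := Real.sin (α (j + 1))) hr
      (by linarith : |δ| < R) hκ (Real.cos_sq_add_sin_sq _)
      (Real.cos_sq_add_sin_sq _) (tangent j j (hl j)) (tangent (j + 1) j (hr' j)) (hangle j)
      (hcirc j) ?_]
    · rw [EuclideanSpace.dist_eq, Fin.sum_univ_two, Real.dist_eq, Real.dist_eq, sq_abs, sq_abs,
        ← (hinv j).1, ← (hinv j).2, ← (hinv (j + 1)).1, ← (hinv (j + 1)).2]
      congr 2
      ring
    · have h := (mem_polarCircle ha' hb' hf0').1 (hQC j)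
      rw [hκ2, hm, hrdef]
      field_simp
      linear_combination (-b ^ 4) * h - b ^ 2 * ρ ^ 4 * hf0
  have hshift : ∑ j, Real.cos (α (j + 1)) = ∑ j, Real.cos (α j) :=
    Equiv.sum_comp (Equiv.addRight (1 : ZMod N)) fun j => Real.cos (α j)
  rw [perimeter]
  simp only [hdist]
  rw [Finset.sum_add_distrib, Finset.sum_const, ← Finset.mul_sum, Finset.sum_add_distrib, hshift,
    hsum]
  simp

end ConfocalBilliard

end

/-! ### Assembly -/

theorem corollary1 (a b a' b' ρ : ℝ) (f : Plane) (N : ℕ) [NeZero N]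
    (hb : 0 < b) (hab : b < a) (ha' : 0 < a') (hb' : 0 < b')
    (hnested : a' < a) (hconfocal : a' ^ 2 - b' ^ 2 = a ^ 2 - b ^ 2)
    (hf : f ∈ foci a b) (hρ : 0 < ρ) (hN : 3 ≤ N) :
    (∃ L : ℝ, ∀ P ∈ periodics a b a' b' N, perimeter (invert f ρ P) = L) ∧
    ∃ Cext Cint : EuclideanGeometry.Sphere Plane,
      0 < Cint.radius ∧
      dist Cext.center Cint.center + Cint.radius < Cext.radius ∧
      polarCurve f ρ (ellipse a b) = (Cint : Set Plane) ∧
      polarCurve f ρ (ellipse a' b') = (Cext : Set Plane) ∧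
      IsLimitingPoint Cext Cint f ∧
      dist f Cint.center < Cint.radius ∧
      (∀ P ∈ periodics a b a' b' N, ∃ Q ∈ bicentrics Cext Cint N,
        IsPolarPolygon f ρ P Q ∧ ∀ j, pedal f Q j = invert f ρ P (j + 1)) ∧
      (∀ Q ∈ bicentrics Cext Cint N, ∃ P ∈ periodics a b a' b' N,
        IsPolarPolygon f ρ P Q ∧ ∀ j, pedal f Q j = invert f ρ P (j + 1)) := by
  have ha : 0 < a := hb.trans hab
  have hsq : 0 ≤ a ^ 2 - b ^ 2 := by
    have : b ^ 2 < a ^ 2 := by gcongr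
    linarith
  have hf01 : f 0 ^ 2 = a ^ 2 - b ^ 2 ∧ f 1 = 0 := by
    rcases hf with rfl | rfl <;> simp [Real.sq_sqrt hsq]
  obtain ⟨hf0, hf1⟩ := hf01
  have hf0' : f 0 ^ 2 = a' ^ 2 - b' ^ 2 := by rw [hf0, hconfocal]
  -- Polarity reverses nesting: the inner ellipse supplies the outer circle.
  refine ⟨exists_perimeter_invert_eq hb hab ha' hb' hnested hconfocal hρ hf0 hf1 N,
    polarCircle f ρ a' b', polarCircle f ρ a b, ?_, ?_,
    polarCurve_ellipse ha hb hρ hf0 hf1, polarCurve_ellipse ha' hb' hρ hf0' hf1,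
    isLimitingPoint_polarCircle ha hb ha' hb' (lt_minor hb ha' hnested hconfocal) hconfocal hρ
      hf0 hf1,
    dist_focus_center_lt ha hb hρ hf0 hf1, fun P hP => ?_, fun Q hQ =>
      exists_periodic_of_bicentric hb hab ha' hb' hnested hconfocal hρ hf0 hf1 hQ⟩
  · change 0 < ρ ^ 2 * a / b ^ 2
    positivity
  · have h := polarCircle_nested ha hb ha' hb' hnested hconfocal hρ hf0
    simp only [polarCircle, dist_horizontal]
    rw [add_sub_add_left_eq_sub]
    linarith
  · obtain ⟨Q, hQ, hpolar, -, hpedal⟩ := exists_bicentric_of_periodic hb hab ha' hb' hnested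
      hconfocal hρ hf0 hf1 hP
    exact ⟨Q, hQ, hpolar, hpedal⟩
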